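/- **Setting.** Let $M$ be a smooth $n$-dimensional manifold and $E=\mathbb R\times TM$, with the natural coordinates $(t,x^a,u^a)$ induced by charts $(x^a)$ of $M$. Let $\Gamma$ be a smooth semispray on $E$, i.e. a smooth vector field of the form $\Gamma=\partial_t+u^a\partial_{x^a}+f^a\partial_{u^a}$ in all natural coordinates. Put $$\Gamma^a_b=-\tfrac12\frac{\partial f^a}{\partial u^b},\quad V_a=\frac{\partial}{\partial u^a},\quad H_a=\frac{\partial}{\partial x^a}-\Gamma^b_a\frac{\partial}{\partial u^b},\quad \theta^a=dx^a-u^a\,dt,\quad \psi^a=du^a-f^a\,dt+\Gamma^a_b\theta^b .$$ Let $\nabla$ be the Massa–Pagani connection of $\Gamma$, given by $\nabla_X\Gamma=0$, $\nabla_X H_b=\omega^a_b(X)H_a$, $\nabla_X V_b=\omega^a_b(X)V_a$ with $\omega^a_b=\Gamma^a_b\,dt+\frac{\partial\Gamma^a_b}{\partial u^c}\theta^c$, and let $T(X,Y)=\nabla_XY-\nabla_YX-[X,Y]$ be its torsion. For a 2-form $\Omega$ put $$T_\Omega(X_1,X_2,X_3)=\Omega(T(X_1,X_2),X_3)-\Omega(T(X_1,X_3),X_2)+\Omega(T(X_2,X_3),X_1),$$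 $$\Xi_\Omega(X_1,X_2,X_3)=-(\nabla_{X_1}\Omega)(X_2,X_3)+(\nabla_{X_2}\Omega)(X_1,X_3)-(\nabla_{X_3}\Omega)(X_1,X_2).$$ For a smooth function $L$ on an open subset of $E$ let $\theta_L=L\,dt+\frac{\partial L}{\partial u^a}\theta^a$ be its Cartan 1-form; $L$ is a regular Lagrangian if $\det\big(\frac{\partial^2L}{\partial u^a\partial u^b}\big)\neq0$ everywhere on that subset. **Theorem.** Let $\Omega$ be a smooth 2-form on $E$ which in all natural coordinates is of the form $\Omega=g_{ab}\,\psi^a\wedge\theta^b$ with smooth functions $g_{ab}$. Then the following are equivalent. 1. $\Omega$ is locally $d\theta_L$ for some regular Lagrangian $L$: every point of $E$ has an open neighbourhood $W$ with a smooth regular Lagrangian $L$ on $W$ such that $\Omega=d\theta_L$ on $W$. 2. $\Omega$ has maximal rank (that is, rank $2n$ at every point of $E$) and, in all natural coordinates and for all indices $a,b,c$, $$T_\Omega(\Gamma,V_a,V_b)=0,\quad T_\Omega(\Gamma,H_a,H_b)=0,\quad \Xi_\Omega(\Gamma,V_a,H_b)=0,\quad \Xi_\Omega(V_a,V_b,H_c)=0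 .$$ Moreover, if 2 holds, then for every chart of $M$ with domain $U$ and star-shaped image in $\mathbb R^n$ there is a regular Lagrangian $L$ on all of $\mathbb R\times TU$ with $\Omega=d\theta_L$ on $\mathbb R\times TU$. -/

import Mathlib

open scoped Manifold ContDiff Topology

noncomputable section

namespace Evolution

/-! ### Calculus on the coordinate space with coordinates `(t, x, u)` -/

/-- The space `ℝⁿ`. -/
abbrev Rn (n : ℕ) : Type := EuclideanSpace ℝ (Fin n)

/-- The space `ℝ × ℝⁿ × ℝⁿ` of natural coordinates `(t, x, u)`. -/
abbrev Coord (n : ℕ) : Type := ℝ × (Rn n × Rn n)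

/-- Vector fields on the coordinate space. -/
abbrev VField (n : ℕ) : Type := Coord n → Coord n

/-- Differential `p`-forms on the coordinate space. -/
abbrev Form (n p : ℕ) : Type := Coord n → Coord n [⋀^Fin p]→L[ℝ] ℝ

section Coordinates

variable {n : ℕ}

/-- The coordinate vector `∂/∂x^a`. -/
def dx (a : Fin n) : Coord n := (0, (EuclideanSpace.single a 1, 0))

/-- The coordinate vector `∂/∂u^a`. -/
def du (a : Fin n) : Coord n := (0, (0, EuclideanSpace.single a 1))

/-- The vertical coordinate field `V_a = ∂/∂u^a`. -/
def V (a : Fin n) : VField n := fun _ => du a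

/-- The semispray `∂/∂t + u^a ∂/∂x^a + f^a ∂/∂u^a` with forces `f`. -/
def spray (f : Coord n → Rn n) : VField n := fun y => (1, (y.2.2, f y))

/-- `Γ^a_b = -½ ∂f^a/∂u^b`. -/
def connCoeff (f : Coord n → Rn n) (a b : Fin n) (y : Coord n) : ℝ :=
  -(1 / 2) * fderiv ℝ (fun z => f z a) y (du b)

/-- The horizontal field `H_a = ∂/∂x^a - Γ^b_a ∂/∂u^b`. -/
def H (f : Coord n → Rn n) (a : Fin n) : VField n :=
  fun y => dx a - ∑ b, connCoeff f b a y • du b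

/-- The 1-form `dt`. -/
def formT : Coord n →L[ℝ] ℝ := ContinuousLinearMap.fst ℝ ℝ (Rn n × Rn n)

/-- The coordinate 1-form `dx^a`. -/
def formX (a : Fin n) : Coord n →L[ℝ] ℝ :=
  (EuclideanSpace.proj a : Rn n →L[ℝ] ℝ) ∘L
    ContinuousLinearMap.fst ℝ (Rn n) (Rn n) ∘L ContinuousLinearMap.snd ℝ ℝ (Rn n × Rn n)

/-- The coordinate 1-form `du^a`. -/
def formU (a : Fin n) : Coord n →L[ℝ] ℝ :=
  (EuclideanSpace.proj a : Rn n →L[ℝ] ℝ) ∘L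
    ContinuousLinearMap.snd ℝ (Rn n) (Rn n) ∘L ContinuousLinearMap.snd ℝ ℝ (Rn n × Rn n)

/-- The contact form `θ^a = dx^a - u^a dt`. -/
def theta (a : Fin n) (y : Coord n) : Coord n →L[ℝ] ℝ :=
  formX a - y.2.2 a • formT

/-- The form `ψ^a = du^a - f^a dt + Γ^a_b θ^b`. -/
def psi (f : Coord n → Rn n) (a : Fin n) (y : Coord n) : Coord n →L[ℝ] ℝ :=
  formU a - f y a • formT + ∑ b, connCoeff f a b y • theta b y

/-- The forms `ω^a_b` of the Massa–Pagani connection: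
`ω^a_b = Γ^a_b dt + (∂Γ^a_b/∂u^c) θ^c`. -/
def connForm (f : Coord n → Rn n) (a b : Fin n) (y : Coord n) : Coord n →L[ℝ] ℝ :=
  connCoeff f a b y • formT + ∑ c, fderiv ℝ (connCoeff f a b) y (du c) • theta c y

/-- The covariant derivative `∇_X Y` of the Massa–Pagani connection of the semispray with forces
`f`. On the frame `(Γ, H_a, V_a)`, dual to `(dt, θ^a, ψ^a)`, the connection is
`∇_X Γ = 0`, `∇_X H_b = ω^a_b(X) H_a`, `∇_X V_b = ω^a_b(X) V_a`; that is, its nonzero components are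
`∇_Γ H_b = Γ^a_b H_a`, `∇_Γ V_b = Γ^a_b V_a`, `∇_{H_c} H_b = V_c(Γ^a_b) H_a` and
`∇_{H_c} V_b = V_c(Γ^a_b) V_a`. It is extended to all fields `Y` by the Leibniz rule. -/
def cov (f : Coord n → Rn n) (X Y : VField n) : VField n := fun y =>
  fderiv ℝ (fun z => formT (Y z)) y (X y) • spray f y
    + ∑ a, (fderiv ℝ (fun z => theta a z (Y z)) y (X y)
        + ∑ b, connForm f a b y (X y) * theta b y (Y y)) • H f a y
    + ∑ a, (fderiv ℝ (fun z => psi f a z (Y z)) y (X y)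
        + ∑ b, connForm f a b y (X y) * psi f b y (Y y)) • V a y

/-- The torsion `T(X, Y) = ∇_X Y - ∇_Y X - [X, Y]`. -/
def torsion (f : Coord n → Rn n) (X Y : VField n) : VField n := fun y =>
  cov f X Y y - cov f Y X y - VectorField.lieBracket ℝ X Y y

/-- The covariant derivative `(∇_X Ω)(Y, Z)` of a 2-form. -/
def covForm (f : Coord n → Rn n) (Ω : Form n 2) (X Y Z : VField n) (y : Coord n) : ℝ :=
  fderiv ℝ (fun z => Ω z ![Y z, Z z]) y (X y)
    - Ω y ![cov f X Y y, Z y] - Ω y ![Y y, cov f X Z y]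

/-- `Ξ_Ω(X₁, X₂, X₃) = ∑ᵢ (-1)^i (∇_{Xᵢ} Ω)(…, omit Xᵢ, …)` for a 2-form. -/
def Xi (f : Coord n → Rn n) (Ω : Form n 2) (X₁ X₂ X₃ : VField n) (y : Coord n) : ℝ :=
  -covForm f Ω X₁ X₂ X₃ y + covForm f Ω X₂ X₁ X₃ y - covForm f Ω X₃ X₁ X₂ y

/-- `T_Ω(X₁, X₂, X₃) = ∑_{i<j} (-1)^(i+j+1) Ω(T(Xᵢ, Xⱼ), …, omit Xᵢ, Xⱼ, …)` for a 2-form. -/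
def TForm (f : Coord n → Rn n) (Ω : Form n 2) (X₁ X₂ X₃ : VField n) (y : Coord n) : ℝ :=
  Ω y ![torsion f X₁ X₂ y, X₃ y] - Ω y ![torsion f X₁ X₃ y, X₂ y]
    + Ω y ![torsion f X₂ X₃ y, X₁ y]

/-- The Cartan 1-form `θ_L = L dt + (∂L/∂u^a)(dx^a - u^a dt)`. -/
def cartan (L : Coord n → ℝ) : Form n 1 := fun y =>
  ContinuousAlternatingMap.ofSubsingleton ℝ (Coord n) ℝ (0 : Fin 1)
    (L y • formT + ∑ a, fderiv ℝ L y (du a) • theta a y)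

/-- The matrix `∂²L/∂u^a∂u^b`. -/
def hessian (L : Coord n → ℝ) (y : Coord n) : Matrix (Fin n) (Fin n) ℝ :=
  fun a b => fderiv ℝ (fun z => fderiv ℝ L z (du b)) y (du a)

end Coordinates

/-! ### The evolution space `E = ℝ × TM` and its natural coordinates -/

/-- The evolution space `ℝ × TM`. -/
abbrev Evo (n : ℕ) (M : Type*) [TopologicalSpace M] [ChartedSpace (Rn n) M] : Type _ :=
  ℝ × TangentBundle (𝓡 n) M

/-- The model with corners of the evolution space. -/
abbrev evoModel (n : ℕ) : ModelWithCorners ℝ (Coord n) (ModelProd ℝ (ModelProd (Rn n) (Rn n))) :=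
  𝓘(ℝ, ℝ).prod (𝓡 n).tangent

section Manifold

variable {n : ℕ} {M : Type*} [TopologicalSpace M] [ChartedSpace (Rn n) M] [IsManifold (𝓡 n) ∞ M]

/-- The smooth charts of `M`: the charts of its maximal atlas. -/
abbrev Charts (n : ℕ) (M : Type*) [TopologicalSpace M] [ChartedSpace (Rn n) M] :
    Set (OpenPartialHomeomorph M (Rn n)) :=
  IsManifold.maximalAtlas (𝓡 n) ∞ M

/-- The range `ℝ × x(U) × ℝⁿ` of the natural coordinates `(t, x, u)` on `ℝ × TU` that are induced
by a chart `x` of `M` with domain `U`. -/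
def coordDom (e : OpenPartialHomeomorph M (Rn n)) : Set (Coord n) := {y | y.2.1 ∈ e.target}

/-- The inverse of the natural coordinates `(t, x, u)` induced by a chart of `M`: it sends
`(t, x, u)` to `t` and the tangent vector `u^a ∂/∂x^a` at the point with coordinates `x`. -/
def natInv (e : OpenPartialHomeomorph M (Rn n)) (y : Coord n) : Evo n M :=
  (y.1, ⟨e.symm y.2.1, mfderiv (𝓡 n) (𝓡 n) e.symm y.2.1 y.2.2⟩)

/-- Vector fields on the evolution space. -/
abbrev EvoField (n : ℕ) (M : Type*) [TopologicalSpace M] [ChartedSpace (Rn n) M]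
    [IsManifold (𝓡 n) ∞ M] : Type _ :=
  (p : Evo n M) → TangentSpace (evoModel n) p

/-- 2-forms on the evolution space. -/
abbrev EvoForm (n : ℕ) (M : Type*) [TopologicalSpace M] [ChartedSpace (Rn n) M]
    [IsManifold (𝓡 n) ∞ M] : Type _ :=
  (p : Evo n M) → (TangentSpace (evoModel n) p) [⋀^Fin 2]→L[ℝ] ℝ

/-- The expression of a vector field in the natural coordinates induced by a chart of `M`. -/
def fieldIn (e : OpenPartialHomeomorph M (Rn n)) (G : EvoField n M) : VField n :=
  VectorField.mpullback 𝓘(ℝ, Coord n) (evoModel n) (natInv e) G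

/-- The expression of a 2-form in the natural coordinates induced by a chart of `M`. -/
def formIn (e : OpenPartialHomeomorph M (Rn n)) (Ω : EvoForm n M) : Form n 2 := fun y =>
  (Ω (natInv e y)).compContinuousLinearMap
    (mfderiv 𝓘(ℝ, Coord n) (evoModel n) (natInv e) y)

/-- A semispray: a smooth vector field which in all natural coordinates has the form
`∂/∂t + u^a ∂/∂x^a + f^a ∂/∂u^a`. -/
def IsSemispray (G : EvoField n M) : Prop :=
  ∀ e ∈ Charts n M, ContDiffOn ℝ ∞ (fieldIn e G) (coordDom e) ∧
    ∀ y ∈ coordDom e, (fieldIn e G y).1 = 1 ∧ (fieldIn e G y).2.1 = y.2.2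

/-- The forces `f^a` of a semispray in natural coordinates. -/
def forceIn (e : OpenPartialHomeomorph M (Rn n)) (G : EvoField n M) : Coord n → Rn n :=
  fun y => (fieldIn e G y).2.2

/-- `Ω` is a smooth 2-form of the form `g_ab ψ^a ∧ θ^b` in all natural coordinates. -/
def IsMultiplierForm (G : EvoField n M) (Ω : EvoForm n M) : Prop :=
  ∀ e ∈ Charts n M, ∃ g : Fin n → Fin n → Coord n → ℝ,
    (∀ a b, ContDiffOn ℝ ∞ (g a b) (coordDom e)) ∧
    ∀ y ∈ coordDom e, ∀ X Y : Coord n, formIn e Ω y ![X, Y] =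
      ∑ a, ∑ b, g a b y * (psi (forceIn e G) a y X * theta b y Y
        - psi (forceIn e G) a y Y * theta b y X)

/-- `Ω` has maximal rank: at every point of the `(2n+1)`-dimensional evolution space,
the linear map `X ↦ Ω(X, ·)` has rank `2n`. -/
def HasMaximalRank (Ω : EvoForm n M) : Prop :=
  ∀ p : Evo n M, Module.finrank ℝ (LinearMap.range (Ω p).toAlternatingMap.curryLeft) = 2 * n

/-- `L` is a (smooth) regular Lagrangian on the subset `W` of the evolution space:
`det (∂²L/∂u^a∂u^b) ≠ 0` in all natural coordinates at the points of `W`. -/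
def IsRegularLagrangianOn (L : Evo n M → ℝ) (W : Set (Evo n M)) : Prop :=
  ContMDiffOn (evoModel n) 𝓘(ℝ, ℝ) ∞ L W ∧
    ∀ e ∈ Charts n M, ∀ y ∈ coordDom e, natInv e y ∈ W → (hessian (L ∘ natInv e) y).det ≠ 0

/-- `Ω = dθ_L` at the points of `W`, where `θ_L` is the Cartan 1-form of `L`. -/
def EqDCartanOn (Ω : EvoForm n M) (L : Evo n M → ℝ) (W : Set (Evo n M)) : Prop :=
  ∀ e ∈ Charts n M, ∀ y ∈ coordDom e, natInv e y ∈ W →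
    formIn e Ω y = extDeriv (cartan (L ∘ natInv e)) y

/-- `Ω` is the exterior derivative of the Cartan 1-form of some regular Lagrangian on a
neighbourhood of every point of the evolution space. -/
def IsLocallyDCartan (Ω : EvoForm n M) : Prop :=
  ∀ p : Evo n M, ∃ W : Set (Evo n M), IsOpen W ∧ p ∈ W ∧ ∃ L : Evo n M → ℝ,
    IsRegularLagrangianOn L W ∧ EqDCartanOn Ω L W

/-- The four component conditions on `Ω`, in all natural coordinates. -/
def ComponentConditions (G : EvoField n M) (Ω : EvoForm n M) : Prop :=
  ∀ e ∈ Charts n M, ∀ y ∈ coordDom e,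
    (∀ a b, TForm (forceIn e G) (formIn e Ω) (spray (forceIn e G)) (V a) (V b) y = 0) ∧
    (∀ a b, TForm (forceIn e G) (formIn e Ω) (spray (forceIn e G))
      (H (forceIn e G) a) (H (forceIn e G) b) y = 0) ∧
    (∀ a b, Xi (forceIn e G) (formIn e Ω) (spray (forceIn e G))
      (V a) (H (forceIn e G) b) y = 0) ∧
    (∀ a b c, Xi (forceIn e G) (formIn e Ω) (V a) (V b) (H (forceIn e G) c) y = 0)

end Manifold

end Evolution

end

/-!
For every connection with torsion `T` and every 2-form `Ω` one has `dΩ = T_Ω - Ξ_Ω`. If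
`Ω = g_ab ψ^a ∧ θ^b`, then `Ω` annihilates `Γ` and all pairs of vertical and all pairs of horizontal
fields, the Massa–Pagani connection preserves the splitting into `Γ`, horizontal and vertical
fields, `T(Γ, V_a)` is horizontal and `T(Γ, H_a)`, `T(V_a, H_b)` are vertical. Hence in each of the
four component conditions only one of `T_Ω`, `Ξ_Ω` survives, and the conditions say that `dΩ`
vanishes on `(Γ, V, V)`, `(Γ, H, H)`, `(Γ, V, H)` and `(V, V, H)`. In particular they hold if
`Ω = dθ_L`.

Conversely the conditions imply `dΩ = 0` (`Evolution.MultiplierData.extDeriv_eq_zero`). The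
component on `(V, V, V)` vanishes since `Ω` does on vertical pairs. Now `Γ` lies in the kernel of the
closed form `dΩ`, so the Lie derivative of `dΩ` along `Γ` is zero. As `[V_a, Γ]` is
`∂/∂x^a` up to vertical terms, the Lie derivative of the component on `(V, V, H)` shows that
`A_abc = dΩ(V_a, H_b, H_c)` is symmetric in `a, b`; being antisymmetric in `b, c`, it vanishes. The
Lie derivative of the component on `(V, H, H)` then gives the one on `(H, H, H)`.

A closed `Ω` on `ℝ × U × ℝⁿ` with `U` star-shaped has a primitive `α` by the homotopy formula
(`fderiv_homotopyForm`). The fibres are contracted to the zero section first, and the base to a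
point afterwards; since `Ω` vanishes on vertical pairs, this `α` vanishes on vertical vectors. The
equation `Ω(V_a, ∂/∂t + u^b ∂/∂x^b) = 0` then says that `α` is the Cartan form of
`L = α(∂/∂t + u^b ∂/∂x^b)` (`Evolution.eq_cartanCLM`). The Cartan form is natural under changes of
natural coordinates (`Evolution.cartanCLM_comp_prolong`), so `L` serves in all charts.

Finally `g_ab = Ω(∂/∂u^a, ∂/∂x^b)` is the Hessian of `L` whenever `Ω = dθ_L`, and `Ω` has rank `2n`
exactly where `det (g_ab) ≠ 0` (`Evolution.MultiplierData.ker_iff_det_ne_zero`), which relates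
regularity to maximal rank.
-/

/-! ### Smooth dependence of an integral on a parameter -/

section ParametricIntegral

open Set MeasureTheory

variable {E G : Type*} [NormedAddCommGroup E] [NormedSpace ℝ E]
  [NormedAddCommGroup G] [NormedSpace ℝ G]

theorem hasFDerivAt_integral_unitInterval {O : Set (E × ℝ)} (hO : IsOpen O) {f : E × ℝ → G}
    (hf : ContDiffOn ℝ 1 f O) {y : E} (hy : ∀ s ∈ Icc (0 : ℝ) 1, (y, s) ∈ O) :
    HasFDerivAt (fun z => ∫ s in (0 : ℝ)..1, f (z, s))
      (∫ s in (0 : ℝ)..1, (fderiv ℝ f (y, s)).comp (ContinuousLinearMap.inl ℝ E ℝ)) y := by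
  have hf' : ContinuousOn (fderiv ℝ f) O := hf.continuousOn_fderiv_of_isOpen hO le_rfl
  have hdiff : ∀ p ∈ O, DifferentiableAt ℝ f p := fun p hp =>
    (hf.differentiableOn one_ne_zero).differentiableAt (hO.mem_nhds hp)
  have hK : IsCompact (({y} : Set E) ×ˢ Icc (0 : ℝ) 1) := isCompact_singleton.prod isCompact_Icc
  have hKO : ({y} : Set E) ×ˢ Icc (0 : ℝ) 1 ⊆ O := by
    rintro ⟨z, s⟩ ⟨hz, hs⟩
    obtain rfl : z = y := hz
    exact hy s hs
  -- the derivative is bounded near the compact segment, uniformly on a tube around it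
  obtain ⟨C, hC⟩ := hK.exists_bound_of_continuousOn (hf'.mono hKO)
  have hO' : IsOpen (O ∩ (fun p => ‖fderiv ℝ f p‖) ⁻¹' Iio (C + 1)) :=
    hf'.norm.isOpen_inter_preimage hO isOpen_Iio
  have hKO' : ({y} : Set E) ×ˢ Icc (0 : ℝ) 1 ⊆ O ∩ (fun p => ‖fderiv ℝ f p‖) ⁻¹' Iio (C + 1) :=
    fun p hp => ⟨hKO hp, (hC p hp).trans_lt (lt_add_one C)⟩
  obtain ⟨u, v, hu, -, hyu, hv, huv⟩ :=
    generalized_tube_lemma isCompact_singleton isCompact_Icc hO' hKO'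
  have hsl : ∀ z ∈ u, MapsTo (fun s : ℝ => (z, s)) (Icc 0 1) O :=
    fun z hz s hs => (huv (mk_mem_prod hz (hv hs))).1
  have hsub : uIoc (0 : ℝ) 1 ⊆ Icc 0 1 := by
    rw [uIoc_of_le zero_le_one]; exact Ioc_subset_Icc_self
  have hcont : ∀ z ∈ u, ContinuousOn (fun s : ℝ => f (z, s)) (Icc 0 1) := fun z hz =>
    hf.continuousOn.comp (by fun_prop) (hsl z hz)
  have hcont' : ContinuousOn (fun s : ℝ => (fderiv ℝ f (y, s)).comp
      (ContinuousLinearMap.inl ℝ E ℝ)) (Icc 0 1) :=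
    (hf'.comp (by fun_prop) (hsl y (hyu rfl))).clm_comp continuousOn_const
  refine intervalIntegral.hasFDerivAt_integral_of_dominated_of_fderiv_le
    (F' := fun z s => (fderiv ℝ f (z, s)).comp (ContinuousLinearMap.inl ℝ E ℝ))
    (bound := fun _ => (C + 1) * ‖ContinuousLinearMap.inl ℝ E ℝ‖)
    (hu.mem_nhds (hyu rfl)) ?_ ?_ ?_ ?_ ?_ ?_
  · filter_upwards [hu.mem_nhds (hyu rfl)] with z hz
    exact ((hcont z hz).mono hsub).aestronglyMeasurable measurableSet_uIoc
  · exact ContinuousOn.intervalIntegrable (by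
      rw [uIcc_of_le zero_le_one]; exact hcont y (hyu rfl))
  · exact (hcont'.mono hsub).aestronglyMeasurable measurableSet_uIoc
  · refine Filter.Eventually.of_forall fun s hs z hz => ?_
    refine (ContinuousLinearMap.opNorm_comp_le _ _).trans ?_
    gcongr
    exact (huv (mk_mem_prod hz (hv (hsub hs)))).2.le
  · exact intervalIntegrable_const
  · refine Filter.Eventually.of_forall fun s hs z hz => ?_
    exact (hdiff _ (hsl z hz (hsub hs))).hasFDerivAt.comp z (hasFDerivAt_prodMk_left z s)

/-- The order of differentiability is reduced to a natural number, and each derivative is again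
an integral of the same kind. -/
theorem contDiffOn_integral_unitInterval.{u} {E G : Type u} [NormedAddCommGroup E]
    [NormedSpace ℝ E] [NormedAddCommGroup G] [NormedSpace ℝ G] {S : Set E} (hS : IsOpen S)
    {O : Set (E × ℝ)} (hO : IsOpen O) (hSO : ∀ y ∈ S, ∀ s ∈ Icc (0 : ℝ) 1, (y, s) ∈ O)
    {f : E × ℝ → G} (hf : ContDiffOn ℝ ∞ f O) :
    ContDiffOn ℝ ∞ (fun y => ∫ s in (0 : ℝ)..1, f (y, s)) S := by
  rw [contDiffOn_infty]
  intro k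
  induction k generalizing G with
  | zero =>
    refine contDiffOn_zero.2 fun y hy => ContinuousAt.continuousWithinAt ?_
    exact (hasFDerivAt_integral_unitInterval hO (hf.of_le (mod_cast le_top))
      (hSO y hy)).continuousAt
  | succ k ih =>
    have hder : ∀ y ∈ S, HasFDerivAt (fun z => ∫ s in (0 : ℝ)..1, f (z, s)) _ y := fun y hy =>
      hasFDerivAt_integral_unitInterval hO (hf.of_le (mod_cast le_top)) (hSO y hy)
    rw [Nat.cast_succ, contDiffOn_succ_iff_fderiv_of_isOpen hS]
    refine ⟨fun y hy => (hder y hy).differentiableAt.differentiableWithinAt, by simp, ?_⟩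
    refine ContDiffOn.congr (ih (f := fun p => (fderiv ℝ f p).comp
      (ContinuousLinearMap.inl ℝ E ℝ)) ?_) fun y hy => (hder y hy).fderiv
    exact ((contDiffOn_infty_iff_fderiv_of_isOpen hO).1 hf).2.clm_comp contDiffOn_const

end ParametricIntegral

/-! ### The homotopy operator on 2-forms -/

section Homotopy

open Set

variable {E : Type*} [NormedAddCommGroup E] [NormedSpace ℝ E]

/-- An alternating 2-form as a bilinear form. -/
noncomputable def toBilin : (E [⋀^Fin 2]→L[ℝ] ℝ) →L[ℝ] (E →L[ℝ] E →L[ℝ] ℝ) :=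
  (ContinuousLinearMap.compL ℝ E (E [⋀^Fin 1]→L[ℝ] ℝ) (E →L[ℝ] ℝ)
      ((ContinuousAlternatingMap.ofSubsingletonLIE (𝕜 := ℝ) (E := E) (F := ℝ)
        (0 : Fin 1)).symm : (E [⋀^Fin 1]→L[ℝ] ℝ) ≃L[ℝ] (E →L[ℝ] ℝ))) ∘L
    (ContinuousAlternatingMap.curryLeftLI (𝕜 := ℝ) (E := E) (F := ℝ)
      (n := 1)).toContinuousLinearMap

@[simp]
theorem toBilin_apply (η : E [⋀^Fin 2]→L[ℝ] ℝ) (X Y : E) : toBilin η X Y = η ![X, Y] := by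
  simp only [toBilin, ContinuousLinearMap.comp_apply]
  refine congrArg η (funext fun i => ?_)
  fin_cases i <;> rfl

theorem contDiff_toBilin {k : WithTop ℕ∞} :
    ContDiff ℝ k (fun η : E [⋀^Fin 2]→L[ℝ] ℝ => toBilin η) :=
  ContinuousLinearMap.contDiff _

theorem DifferentiableAt.toBilin {Ω : E → E [⋀^Fin 2]→L[ℝ] ℝ} {y : E}
    (h : DifferentiableAt ℝ Ω y) : DifferentiableAt ℝ (fun z => toBilin (Ω z)) y :=
  (contDiff_toBilin.differentiable one_ne_zero).differentiableAt.comp y h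

theorem alt_two_swap (η : E [⋀^Fin 2]→L[ℝ] ℝ) (X Y : E) : η ![X, Y] = -η ![Y, X] := by
  have h := η.toAlternatingMap.map_swap ![Y, X] (i := 0) (j := 1) (by decide)
  rw [← ContinuousAlternatingMap.coe_toAlternatingMap, ← h]
  congr 1
  funext i
  fin_cases i <;> rfl

theorem extDeriv_two_apply {Ω : E → E [⋀^Fin 2]→L[ℝ] ℝ} {y : E} (h : DifferentiableAt ℝ Ω y)
    (X Y Z : E) : extDeriv Ω y ![X, Y, Z] = fderiv ℝ (fun z => Ω z ![Y, Z]) y X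
      - fderiv ℝ (fun z => Ω z ![X, Z]) y Y + fderiv ℝ (fun z => Ω z ![X, Y]) y Z := by
  have h1 : Fin.removeNth 1 ![X, Y, Z] = ![X, Z] := by
    funext i; fin_cases i <;> rfl
  have h2 : Fin.removeNth 2 ![X, Y, Z] = ![X, Y] := by
    funext i; fin_cases i <;> rfl
  rw [extDeriv_apply h]
  simp [Fin.sum_univ_three, h1, h2, sub_eq_add_neg]

theorem extDeriv_one_apply {α : E → E →L[ℝ] ℝ} {y : E} (h : DifferentiableAt ℝ α y) (X Y : E) :
    extDeriv (fun z => ContinuousAlternatingMap.ofSubsingleton ℝ E ℝ (0 : Fin 1) (α z)) y ![X, Y]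
      = fderiv ℝ α y X Y - fderiv ℝ α y Y X := by
  have h1 : Fin.removeNth 1 ![X, Y] 0 = X := rfl
  have h2 : ∀ Z, fderiv ℝ (fun z => α z Z) y = (fderiv ℝ α y).flip Z := fun Z => by
    ext W
    rw [fderiv_clm_apply h (differentiableAt_const _)]
    simp
  have h3 : DifferentiableAt ℝ
      (fun z => ContinuousAlternatingMap.ofSubsingleton ℝ E ℝ (0 : Fin 1) (α z)) y :=
    (ContinuousAlternatingMap.ofSubsingletonLIE (𝕜 := ℝ) (E := E) (F := ℝ)
      (0 : Fin 1)).differentiable.differentiableAt.comp y h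
  rw [extDeriv_apply h3]
  simp [Fin.sum_univ_two, h1, h2, sub_eq_add_neg]

theorem fderiv_toBilin_apply {Ω : E → E [⋀^Fin 2]→L[ℝ] ℝ} {y : E} (h : DifferentiableAt ℝ Ω y)
    (X Y Z : E) :
    fderiv ℝ (fun z => toBilin (Ω z)) y X Y Z = fderiv ℝ (fun z => Ω z ![Y, Z]) y X := by
  have h' := ((h.toBilin.hasFDerivAt.clm_apply (hasFDerivAt_const Y y)).clm_apply
    (hasFDerivAt_const Z y)).fderiv
  simp only [toBilin_apply] at h'
  rw [h']
  simp

/-- The affine map which fixes `b`, with linear part `P + s (1 - P)`: as `s` goes from `0` to `1`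
it deforms `b + P (· - b)` into the identity. -/
noncomputable def deform (P : E →L[ℝ] E) (b : E) (s : ℝ) (y : E) : E :=
  b + (P (y - b) + s • (y - b - P (y - b)))

/-- The linear part of `deform`. -/
noncomputable def deformLin (P : E →L[ℝ] E) (s : ℝ) : E →L[ℝ] E :=
  P + s • (ContinuousLinearMap.id ℝ E - P)

theorem deformLin_apply (P : E →L[ℝ] E) (s : ℝ) (X : E) :
    deformLin P s X = P X + s • (X - P X) := by
  simp [deformLin]

/-- The homotopy operator of the deformation `deform P b`, applied to a 2-form. -/
noncomputable def homotopyForm (P : E →L[ℝ] E) (b : E) (Ω : E → E [⋀^Fin 2]→L[ℝ] ℝ) (y : E) :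
    E →L[ℝ] ℝ :=
  ∫ s in (0 : ℝ)..1, (toBilin (Ω (deform P b s y)) (y - b - P (y - b))).comp (deformLin P s)

variable {P : E →L[ℝ] E} {b : E} {Ω : E → E [⋀^Fin 2]→L[ℝ] ℝ} {S : Set E}

theorem contDiff_deform : ContDiff ℝ ∞ (fun p : E × ℝ => deform P b p.2 p.1) := by
  unfold deform
  fun_prop

theorem contDiff_deformLin : ContDiff ℝ ∞ (deformLin P) := by
  unfold deformLin
  fun_prop

theorem contDiffOn_homotopy_integrand (hΩ : ContDiffOn ℝ ∞ Ω S) :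
    ContDiffOn ℝ ∞ (fun p : E × ℝ => (toBilin (Ω (deform P b p.2 p.1))
      (p.1 - b - P (p.1 - b))).comp (deformLin P p.2)) {p | deform P b p.2 p.1 ∈ S} := by
  have h1 : ContDiffOn ℝ ∞ (fun p : E × ℝ => toBilin (Ω (deform P b p.2 p.1)))
      {p | deform P b p.2 p.1 ∈ S} :=
    contDiff_toBilin.comp_contDiffOn (hΩ.comp contDiff_deform.contDiffOn fun p hp => hp)
  refine ContDiffOn.clm_comp (h1.clm_apply ?_) ?_
  · exact ContDiff.contDiffOn (by fun_prop)
  · exact (contDiff_deformLin.comp contDiff_snd).contDiffOn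

theorem contDiffOn_homotopyForm (hS : IsOpen S) (hΩ : ContDiffOn ℝ ∞ Ω S)
    (hdef : ∀ y ∈ S, ∀ s ∈ Icc (0 : ℝ) 1, deform P b s y ∈ S) :
    ContDiffOn ℝ ∞ (homotopyForm P b Ω) S :=
  contDiffOn_integral_unitInterval hS (hS.preimage contDiff_deform.continuous) hdef
    (contDiffOn_homotopy_integrand hΩ)

theorem homotopyForm_apply (hΩ : ContDiffOn ℝ ∞ Ω S) {y : E}
    (hdef : ∀ s ∈ Icc (0 : ℝ) 1, deform P b s y ∈ S) (X : E) :
    homotopyForm P b Ω y X =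
      ∫ s in (0 : ℝ)..1, Ω (deform P b s y) ![y - b - P (y - b), deformLin P s X] := by
  have hint : IntervalIntegrable (fun s => (toBilin (Ω (deform P b s y))
      (y - b - P (y - b))).comp (deformLin P s)) MeasureTheory.volume 0 1 := by
    refine ContinuousOn.intervalIntegrable ?_
    rw [uIcc_of_le zero_le_one]
    exact (contDiffOn_homotopy_integrand hΩ).continuousOn.comp (f := fun s : ℝ => (y, s))
      (by fun_prop) hdef
  rw [homotopyForm, ContinuousLinearMap.intervalIntegral_apply hint]
  simp

theorem hasFDerivAt_deform (s : ℝ) (y : E) : HasFDerivAt (deform P b s) (deformLin P s) y := by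
  have h1 : HasFDerivAt (fun z : E => z - b) (ContinuousLinearMap.id ℝ E) y :=
    (hasFDerivAt_id y).sub_const b
  have h2 : HasFDerivAt (fun z : E => P (z - b)) P y := P.hasFDerivAt.comp y h1
  exact (h2.add ((h1.sub h2).const_smul s)).const_add b

theorem fderiv_homotopy_integrand {s : ℝ} {y : E}
    (h : DifferentiableAt ℝ Ω (deform P b s y)) (X Z : E) {F' : E →L[ℝ] ℝ}
    (hF' : HasFDerivAt (fun z => toBilin (Ω (deform P b s z)) (z - b - P (z - b))
      (deformLin P s Z)) F' y) :
    F' X = fderiv ℝ (fun z => toBilin (Ω z)) (deform P b s y) (deformLin P s X)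
        (y - b - P (y - b)) (deformLin P s Z)
      + Ω (deform P b s y) ![X - P X, deformLin P s Z] := by
  have h1 : HasFDerivAt (fun z : E => z - b) (ContinuousLinearMap.id ℝ E) y :=
    (hasFDerivAt_id y).sub_const b
  have h2 : HasFDerivAt (fun z : E => P (z - b)) P y := P.hasFDerivAt.comp y h1
  have hB : HasFDerivAt (fun z => toBilin (Ω (deform P b s z)))
      ((fderiv ℝ (fun z => toBilin (Ω z)) (deform P b s y)).comp (deformLin P s)) y :=
    HasFDerivAt.comp (g := fun z => toBilin (Ω z)) y h.toBilin.hasFDerivAt (hasFDerivAt_deform s y)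
  have h3 := (hB.clm_apply (h1.sub h2)).clm_apply (hasFDerivAt_const (deformLin P s Z) y)
  rw [hF'.unique h3, ← toBilin_apply]
  simp only [ContinuousLinearMap.comp_zero, zero_add, ContinuousLinearMap.flip_apply,
    _root_.add_apply, ContinuousLinearMap.comp_apply, _root_.sub_apply,
    ContinuousLinearMap.id_apply]
  rw [add_comm]
  rfl

theorem hasDerivAt_pullback_deform {s : ℝ} {y : E}
    (h : DifferentiableAt ℝ Ω (deform P b s y)) (X Z : E) :
    HasDerivAt (fun s => Ω (deform P b s y) ![deformLin P s X, deformLin P s Z])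
      (fderiv ℝ (fun z => toBilin (Ω z)) (deform P b s y) (y - b - P (y - b))
          (deformLin P s X) (deformLin P s Z)
        + Ω (deform P b s y) ![X - P X, deformLin P s Z]
        + Ω (deform P b s y) ![deformLin P s X, Z - P Z]) s := by
  have h1 : HasDerivAt (fun s => deform P b s y) (y - b - P (y - b)) s := by
    have h := (((hasDerivAt_id s).smul_const (y - b - P (y - b))).const_add
      (P (y - b))).const_add b
    rwa [one_smul] at h
  have h2 : ∀ W, HasDerivAt (fun s => deformLin P s W) (W - P W) s := fun W => by
    simp only [deformLin_apply]
    have h := ((hasDerivAt_id s).smul_const (W - P W)).const_add (P W)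
    rwa [one_smul] at h
  have hB : HasDerivAt (fun s => toBilin (Ω (deform P b s y)))
      (fderiv ℝ (fun z => toBilin (Ω z)) (deform P b s y) (y - b - P (y - b))) s :=
    HasFDerivAt.comp_hasDerivAt (l := fun z => toBilin (Ω z)) s h.toBilin.hasFDerivAt h1
  have h3 := (hB.clm_apply (h2 X)).clm_apply (h2 Z)
  simp only [toBilin_apply, _root_.add_apply] at h3
  exact h3

theorem fderiv_toBilin_cyclic {y : E} (h : DifferentiableAt ℝ Ω y) (hc : extDeriv Ω y = 0)
    (X Y Z : E) :
    fderiv ℝ (fun z => toBilin (Ω z)) y X Y Z - fderiv ℝ (fun z => toBilin (Ω z)) y Z Y X =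
      fderiv ℝ (fun z => toBilin (Ω z)) y Y X Z := by
  have hc := congrArg (fun η => η ![X, Y, Z]) hc
  simp only [extDeriv_two_apply h, ← fderiv_toBilin_apply h] at hc
  have hsw : fderiv ℝ (fun z => toBilin (Ω z)) y Z Y X =
      - fderiv ℝ (fun z => toBilin (Ω z)) y Z X Y := by
    rw [fderiv_toBilin_apply h, fderiv_toBilin_apply h]
    simp only [fun z => alt_two_swap (Ω z) Y X]
    rw [fderiv_fun_neg]; simp
  rw [hsw]
  linarith [hc.trans (rfl : _ = (0 : ℝ))]

/-- The homotopy formula `dKΩ = Ω - φ₀^*Ω` for a closed 2-form `Ω`, where `φ₀ = b + P (· - b)`: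
the integrand on the left is the derivative of `φ_s^*Ω` with respect to `s`. -/
theorem fderiv_homotopyForm (hS : IsOpen S) (hΩ : ContDiffOn ℝ ∞ Ω S)
    (hclosed : ∀ y ∈ S, extDeriv Ω y = 0) {y : E}
    (hdef : ∀ s ∈ Icc (0 : ℝ) 1, deform P b s y ∈ S) (X Z : E) :
    fderiv ℝ (homotopyForm P b Ω) y X Z - fderiv ℝ (homotopyForm P b Ω) y Z X =
      Ω y ![X, Z] - Ω (b + P (y - b)) ![P X, P Z] := by
  set O : Set (E × ℝ) := {p | deform P b p.2 p.1 ∈ S}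
  have hO : IsOpen O := hS.preimage contDiff_deform.continuous
  set F : E × ℝ → E →L[ℝ] ℝ := fun p => (toBilin (Ω (deform P b p.2 p.1))
      (p.1 - b - P (p.1 - b))).comp (deformLin P p.2) with hFdef
  have hF : ContDiffOn ℝ ∞ F O := contDiffOn_homotopy_integrand hΩ
  have hF' : ContinuousOn (fderiv ℝ F) O := hF.continuousOn_fderiv_of_isOpen hO (by simp)
  have hcont : ContinuousOn (fun s : ℝ => (fderiv ℝ F (y, s)).comp
      (ContinuousLinearMap.inl ℝ E ℝ)) (uIcc 0 1) := by
    rw [uIcc_of_le zero_le_one]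
    exact (hF'.comp (f := fun s : ℝ => (y, s)) (by fun_prop) hdef).clm_comp continuousOn_const
  have hd : HasFDerivAt (homotopyForm P b Ω) _ y :=
    hasFDerivAt_integral_unitInterval hO (hF.of_le (by simp)) hdef
  have hint : ∀ X Z : E, IntervalIntegrable (fun s : ℝ => fderiv ℝ F (y, s) (X, 0) Z)
      MeasureTheory.volume 0 1 := fun X Z =>
    ((hcont.clm_apply (continuousOn_const (c := X))).clm_apply
      (continuousOn_const (c := Z))).intervalIntegrable
  have hval : ∀ X Z : E, fderiv ℝ (homotopyForm P b Ω) y X Z =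
      ∫ s in (0 : ℝ)..1, fderiv ℝ F (y, s) (X, 0) Z := fun X Z => by
    rw [hd.fderiv, ContinuousLinearMap.intervalIntegral_apply hcont.intervalIntegrable,
      ContinuousLinearMap.intervalIntegral_apply
        (hcont.clm_apply (continuousOn_const (c := X))).intervalIntegrable]
    rfl
  have hBd : ∀ z ∈ S, DifferentiableAt ℝ Ω z := fun z hz =>
    (hΩ.differentiableOn (by simp)).differentiableAt (hS.mem_nhds hz)
  have hder : ∀ s ∈ Icc (0 : ℝ) 1, ∀ X Z : E, fderiv ℝ F (y, s) (X, 0) Z =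
      fderiv ℝ (fun z => toBilin (Ω z)) (deform P b s y) (deformLin P s X)
        (y - b - P (y - b)) (deformLin P s Z)
      + Ω (deform P b s y) ![X - P X, deformLin P s Z] := fun s hs X Z => by
    have hFd : DifferentiableAt ℝ F (y, s) :=
      (hF.differentiableOn (by simp)).differentiableAt (hO.mem_nhds (hdef s hs))
    have e0 : HasFDerivAt (fun z => F (z, s))
        ((fderiv ℝ F (y, s)).comp (ContinuousLinearMap.inl ℝ E ℝ)) y :=
      hFd.hasFDerivAt.comp (f := fun z => (z, s)) y (hasFDerivAt_prodMk_left y s)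
    have e1 := e0.clm_apply (hasFDerivAt_const Z y)
    simpa using fderiv_homotopy_integrand (hBd _ (hdef s hs)) X Z e1
  have hs : ∀ s ∈ uIcc (0 : ℝ) 1, HasDerivAt
      (fun s => Ω (deform P b s y) ![deformLin P s X, deformLin P s Z])
      (fderiv ℝ F (y, s) (X, 0) Z - fderiv ℝ F (y, s) (Z, 0) X) s := fun s hs => by
    rw [uIcc_of_le zero_le_one] at hs
    rw [hder s hs, hder s hs]
    convert hasDerivAt_pullback_deform (hBd _ (hdef s hs)) X Z using 1
    rw [← fderiv_toBilin_cyclic (hBd _ (hdef s hs)) (hclosed _ (hdef s hs)) (deformLin P s X),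
      alt_two_swap _ (Z - P Z)]
    ring
  rw [hval, hval, ← intervalIntegral.integral_sub (hint X Z) (hint Z X),
    intervalIntegral.integral_eq_sub_of_hasDerivAt hs ((hint X Z).sub (hint Z X))]
  simp [deform, deformLin]

end Homotopy

/-! ### Exterior derivative, torsion and covariant derivative -/

section CoordinateTheory

namespace Evolution

variable {n : ℕ} {f : Coord n → Rn n} {Ω : Form n 2} {y : Coord n}

theorem fderiv_form_apply_fields (hΩ : DifferentiableAt ℝ Ω y) {X Y : VField n}
    (hX : DifferentiableAt ℝ X y) (hY : DifferentiableAt ℝ Y y) (v : Coord n) :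
    fderiv ℝ (fun z => Ω z ![X z, Y z]) y v = fderiv ℝ (fun z => Ω z ![X y, Y y]) y v
      + Ω y ![fderiv ℝ X y v, Y y] + Ω y ![X y, fderiv ℝ Y y v] := by
  have h := ((hΩ.toBilin.hasFDerivAt.clm_apply hX.hasFDerivAt).clm_apply hY.hasFDerivAt).fderiv
  simp only [toBilin_apply] at h
  rw [h, ← fderiv_toBilin_apply hΩ]
  simp only [_root_.add_apply, ContinuousLinearMap.comp_apply, ContinuousLinearMap.flip_apply,
    toBilin_apply]
  ring

theorem extDeriv_two_apply_vectorField (hΩ : DifferentiableAt ℝ Ω y) {X Y Z : VField n}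
    (hX : DifferentiableAt ℝ X y) (hY : DifferentiableAt ℝ Y y) (hZ : DifferentiableAt ℝ Z y) :
    extDeriv Ω y ![X y, Y y, Z y] = fderiv ℝ (fun z => Ω z ![Y z, Z z]) y (X y)
      - fderiv ℝ (fun z => Ω z ![X z, Z z]) y (Y y)
      + fderiv ℝ (fun z => Ω z ![X z, Y z]) y (Z y)
      - Ω y ![VectorField.lieBracket ℝ X Y y, Z y]
      + Ω y ![VectorField.lieBracket ℝ X Z y, Y y]
      - Ω y ![VectorField.lieBracket ℝ Y Z y, X y] := by
  rw [extDeriv_two_apply hΩ, fderiv_form_apply_fields hΩ hY hZ, fderiv_form_apply_fields hΩ hX hZ,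
    fderiv_form_apply_fields hΩ hX hY]
  simp only [VectorField.lieBracket_eq]
  rw [alt_two_swap _ (Y y) (fderiv ℝ Z y (X y)), alt_two_swap _ (X y) (fderiv ℝ Z y (Y y)),
    alt_two_swap _ (X y) (fderiv ℝ Y y (Z y))]
  simp only [← toBilin_apply, map_sub, _root_.sub_apply]
  ring

/-- The identity `dΩ = T_Ω - Ξ_Ω`. Only the bilinearity of `Ω` is used: all covariant derivatives
cancel, so it holds for any connection. -/
theorem extDeriv_eq_TForm_sub_Xi (hΩ : DifferentiableAt ℝ Ω y) {X Y Z : VField n}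
    (hX : DifferentiableAt ℝ X y) (hY : DifferentiableAt ℝ Y y) (hZ : DifferentiableAt ℝ Z y) :
    extDeriv Ω y ![X y, Y y, Z y] = TForm f Ω X Y Z y - Xi f Ω X Y Z y := by
  rw [extDeriv_two_apply_vectorField hΩ hX hY hZ]
  simp only [TForm, Xi, covForm, torsion]
  rw [alt_two_swap _ (X y) (cov f Y Z y), alt_two_swap _ (X y) (cov f Z Y y),
    alt_two_swap _ (Y y) (cov f X Z y)]
  simp only [← toBilin_apply, map_sub, _root_.sub_apply]
  simp only [toBilin_apply]
  ring

/-! ### The adapted frame -/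

@[simp] theorem formT_apply (v : Coord n) : formT v = v.1 := rfl
@[simp] theorem formX_apply (a : Fin n) (v : Coord n) : formX a v = v.2.1 a := rfl
@[simp] theorem formU_apply (a : Fin n) (v : Coord n) : formU a v = v.2.2 a := rfl

@[simp] theorem theta_apply (a : Fin n) (y v : Coord n) :
    theta a y v = v.2.1 a - y.2.2 a * v.1 := rfl

@[simp] theorem psi_apply (a : Fin n) (y v : Coord n) :
    psi f a y v = v.2.2 a - f y a * v.1 + ∑ b, connCoeff f a b y * theta b y v := by
  simp [psi]

theorem theta_spray (a : Fin n) (y : Coord n) : theta a y (spray f y) = 0 := by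
  simp [spray]

theorem psi_spray (a : Fin n) (y : Coord n) : psi f a y (spray f y) = 0 := by
  simp [spray]

theorem theta_du (a b : Fin n) (y : Coord n) : theta a y (du b) = 0 := by
  simp [du]

theorem psi_du (a b : Fin n) (y : Coord n) : psi f a y (du b) = if a = b then 1 else 0 := by
  simp [du]

theorem H_fst (a : Fin n) (y : Coord n) : (H f a y).1 = 0 := by
  simp [H, dx, du, Prod.fst_sum]

theorem H_snd_fst (a : Fin n) (y : Coord n) : (H f a y).2.1 = EuclideanSpace.single a 1 := by
  simp [H, dx, du, Prod.fst_sum, Prod.snd_sum]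

theorem H_snd_snd (a b : Fin n) (y : Coord n) : (H f a y).2.2 b = - connCoeff f b a y := by
  simp [H, dx, du, Prod.snd_sum, Pi.single_apply]

theorem theta_H (a b : Fin n) (y : Coord n) :
    theta a y (H f b y) = if a = b then 1 else 0 := by
  simp [H_fst, H_snd_fst]

theorem psi_H (a b : Fin n) (y : Coord n) : psi f a y (H f b y) = 0 := by
  simp only [psi_apply, H_fst, H_snd_snd, theta_H]
  simp

end Evolution
end CoordinateTheory

/-! ### The 2-forms `g_ab ψ^a ∧ θ^b` -/

section Wedge

variable {E : Type*} [NormedAddCommGroup E] [NormedSpace ℝ E]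

/-- The wedge product of two 1-forms. -/
noncomputable def wedge (α β : E →L[ℝ] ℝ) : E [⋀^Fin 2]→L[ℝ] ℝ :=
  ContinuousAlternatingMap.alternatizeUncurryFin
    (α.smulRight (ContinuousAlternatingMap.ofSubsingleton ℝ E ℝ (0 : Fin 1) β))

theorem wedge_apply (α β : E →L[ℝ] ℝ) (X Y : E) :
    wedge α β ![X, Y] = α X * β Y - α Y * β X := by
  have h1 : Fin.removeNth 1 ![X, Y] 0 = X := rfl
  simp [wedge, ContinuousAlternatingMap.alternatizeUncurryFin_apply, Fin.sum_univ_two, h1,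
    sub_eq_add_neg]

theorem contDiffOn_wedge {F : Type*} [NormedAddCommGroup F] [NormedSpace ℝ F] {S : Set F}
    {α β : F → E →L[ℝ] ℝ} {k : WithTop ℕ∞} (hα : ContDiffOn ℝ k α S) (hβ : ContDiffOn ℝ k β S) :
    ContDiffOn ℝ k (fun y => wedge (α y) (β y)) S := by
  have hA : ContDiff ℝ k (ContinuousAlternatingMap.alternatizeUncurryFinCLM ℝ E ℝ (n := 1)) :=
    ContinuousLinearMap.contDiff _
  exact hA.comp_contDiffOn (hα.smulRight
    ((ContinuousAlternatingMap.ofSubsingletonLIE (𝕜 := ℝ) (E := E) (F := ℝ)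
      (0 : Fin 1)).contDiff.comp_contDiffOn hβ))

end Wedge

section CoordinateTheory

namespace Evolution

variable {n : ℕ} {f : Coord n → Rn n} {g : Fin n → Fin n → Coord n → ℝ} {Ω : Form n 2}
  {S : Set (Coord n)} {y : Coord n}

/-- The smooth 2-form `Ω = g_ab ψ^a ∧ θ^b` on an open subset of the coordinate space, where `ψ^a`
belongs to the semispray with smooth forces `f`. -/
structure MultiplierData (f : Coord n → Rn n) (g : Fin n → Fin n → Coord n → ℝ) (Ω : Form n 2)
    (S : Set (Coord n)) : Prop where
  isOpen : IsOpen S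
  force : ContDiffOn ℝ ∞ f S
  coeff : ∀ a b, ContDiffOn ℝ ∞ (g a b) S
  form : ∀ y ∈ S, ∀ X Y : Coord n, Ω y ![X, Y] =
      ∑ a, ∑ b, g a b y * (psi f a y X * theta b y Y - psi f a y Y * theta b y X)

namespace MultiplierData

variable (D : MultiplierData f g Ω S)
include D

theorem contDiffOn_connCoeff (a b : Fin n) : ContDiffOn ℝ ∞ (connCoeff f a b) S := by
  have h : ContDiffOn ℝ ∞ (fun z => f z a) S :=
    (EuclideanSpace.proj (𝕜 := ℝ) a).contDiff.comp_contDiffOn D.force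
  exact contDiffOn_const.mul
    (((contDiffOn_infty_iff_fderiv_of_isOpen D.isOpen).1 h).2.clm_apply contDiffOn_const)

theorem contDiffOn_spray : ContDiffOn ℝ ∞ (spray f) S :=
  contDiffOn_const.prodMk ((contDiff_snd.comp contDiff_snd).contDiffOn.prodMk D.force)

theorem contDiffOn_H (a : Fin n) : ContDiffOn ℝ ∞ (H f a) S :=
  contDiffOn_const.sub (ContDiffOn.sum fun b _ =>
    (D.contDiffOn_connCoeff b a).smul contDiffOn_const)

omit D in
theorem contDiff_theta (a : Fin n) : ContDiff ℝ ∞ (theta (n := n) a) := by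
  have h : ContDiff ℝ ∞ (fun y : Coord n => formU a y) := (formU a).contDiff
  exact contDiff_const.sub (h.smul contDiff_const)

theorem contDiffOn_psi (a : Fin n) : ContDiffOn ℝ ∞ (psi f a) S := by
  have h : ContDiffOn ℝ ∞ (fun z => f z a) S :=
    (EuclideanSpace.proj (𝕜 := ℝ) a).contDiff.comp_contDiffOn D.force
  exact (contDiffOn_const.sub (h.smul contDiffOn_const)).add (ContDiffOn.sum fun b _ =>
    (D.contDiffOn_connCoeff a b).smul (contDiff_theta b).contDiffOn)

theorem contDiffOn_form : ContDiffOn ℝ ∞ Ω S := by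
  have h : ContDiffOn ℝ ∞ (fun y => ∑ a, ∑ b, g a b y • wedge (psi f a y) (theta b y)) S :=
    ContDiffOn.sum fun a _ => ContDiffOn.sum fun b _ =>
      (D.coeff a b).smul (contDiffOn_wedge (D.contDiffOn_psi a) (contDiff_theta b).contDiffOn)
  refine h.congr fun y hy => ?_
  ext v
  have hv : v = ![v 0, v 1] := by funext i; fin_cases i <;> rfl
  rw [hv, D.form y hy]
  simp only [ContinuousAlternatingMap.sum_apply, ContinuousAlternatingMap.smul_apply, wedge_apply,
    smul_eq_mul]

theorem differentiableAt_form (hy : y ∈ S) : DifferentiableAt ℝ Ω y :=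
  (D.contDiffOn_form.differentiableOn (by simp)).differentiableAt (D.isOpen.mem_nhds hy)

theorem differentiableAt_spray (hy : y ∈ S) : DifferentiableAt ℝ (spray f) y :=
  (D.contDiffOn_spray.differentiableOn (by simp)).differentiableAt (D.isOpen.mem_nhds hy)

theorem differentiableAt_force (hy : y ∈ S) : DifferentiableAt ℝ f y :=
  (D.force.differentiableOn (by simp)).differentiableAt (D.isOpen.mem_nhds hy)

theorem differentiableAt_H (a : Fin n) (hy : y ∈ S) : DifferentiableAt ℝ (H f a) y :=
  ((D.contDiffOn_H a).differentiableOn (by simp)).differentiableAt (D.isOpen.mem_nhds hy)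

theorem form_eq_zero_of_theta (hy : y ∈ S) {X Y : Coord n} (hX : ∀ a, theta a y X = 0)
    (hY : ∀ a, theta a y Y = 0) : Ω y ![X, Y] = 0 := by
  rw [D.form y hy]
  exact Finset.sum_eq_zero fun a _ => Finset.sum_eq_zero fun b _ => by rw [hX, hY]; ring

theorem form_eq_zero_of_psi (hy : y ∈ S) {X Y : Coord n} (hX : ∀ a, psi f a y X = 0)
    (hY : ∀ a, psi f a y Y = 0) : Ω y ![X, Y] = 0 := by
  rw [D.form y hy]
  exact Finset.sum_eq_zero fun a _ => Finset.sum_eq_zero fun b _ => by rw [hX, hY]; ring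

theorem form_spray_left (hy : y ∈ S) (X : Coord n) : Ω y ![spray f y, X] = 0 := by
  rw [D.form y hy]
  exact Finset.sum_eq_zero fun a _ => Finset.sum_eq_zero fun b _ => by
    rw [psi_spray, theta_spray]; ring

theorem form_du_dx (hy : y ∈ S) (a b : Fin n) : Ω y ![du a, dx b] = g a b y := by
  have h : ∀ c, theta c y (dx b) = if c = b then 1 else 0 := fun c => by simp [dx]
  rw [D.form y hy]
  simp only [psi_du, theta_du, h]
  simp

end MultiplierData

/-! ### The Massa–Pagani connection on the adapted frame -/

theorem theta_V (a b : Fin n) (y : Coord n) : theta a y (V b y) = 0 := theta_du a b y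

theorem fderiv_V (a : Fin n) (y : Coord n) : fderiv ℝ (V a) y = 0 := fderiv_const_apply _

theorem cov_spray (X : VField n) (y : Coord n) : cov f X (spray f) y = 0 := by
  have h1 : (fun z => formT (spray f z)) = fun _ => (1 : ℝ) := rfl
  simp only [cov, theta_spray, psi_spray, h1]
  simp

theorem cov_V (X : VField n) (b : Fin n) (y : Coord n) :
    cov f X (V b) y = ∑ a, connForm f a b y (X y) • du a := by
  have h1 : (fun z : Coord n => formT (V b z)) = fun _ => (0 : ℝ) := rfl
  simp only [cov, h1]
  simp only [V, theta_du, psi_du]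
  simp

theorem cov_H (X : VField n) (b : Fin n) (y : Coord n) :
    cov f X (H f b) y = ∑ a, connForm f a b y (X y) • H f a y := by
  have h1 : (fun z : Coord n => formT (H f b z)) = fun _ => (0 : ℝ) := funext fun z => H_fst b z
  simp only [cov, h1, theta_H, psi_H]
  simp

theorem theta_cov_V (X : VField n) (a b : Fin n) (y : Coord n) :
    theta a y (cov f X (V b) y) = 0 := by
  rw [cov_V, map_sum]
  exact Finset.sum_eq_zero fun c _ => by rw [map_smul, theta_du, smul_zero]

theorem psi_cov_H (X : VField n) (a b : Fin n) (y : Coord n) :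
    psi f a y (cov f X (H f b) y) = 0 := by
  rw [cov_H, map_sum]
  exact Finset.sum_eq_zero fun c _ => by rw [map_smul, psi_H, smul_zero]

theorem connForm_du (a b c : Fin n) (y : Coord n) : connForm f a b y (du c) = 0 := by
  simp only [connForm, _root_.add_apply, _root_.smul_apply, _root_.sum_apply, theta_du]
  simp [du]

theorem connForm_spray (a b : Fin n) (y : Coord n) :
    connForm f a b y (spray f y) = connCoeff f a b y := by
  simp only [connForm, _root_.add_apply, _root_.smul_apply, _root_.sum_apply, theta_spray]
  simp [spray]

theorem torsion_V_V (a b : Fin n) (y : Coord n) : torsion f (V a) (V b) y = 0 := by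
  rw [torsion, cov_V, cov_V, VectorField.lieBracket_eq]
  beta_reduce
  rw [fderiv_V, fderiv_V]
  simp [V, connForm_du]

namespace MultiplierData

variable (D : MultiplierData f g Ω S)
include D

theorem fderiv_spray_apply (hy : y ∈ S) (v : Coord n) :
    fderiv ℝ (spray f) y v = (0, (v.2.2, fderiv ℝ f y v)) := by
  have h : HasFDerivAt (spray f) ((0 : Coord n →L[ℝ] ℝ).prod
      ((ContinuousLinearMap.snd ℝ (Rn n) (Rn n) ∘L ContinuousLinearMap.snd ℝ ℝ _).prod
        (fderiv ℝ f y))) y :=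
    (hasFDerivAt_const _ _).prodMk
      (((ContinuousLinearMap.snd ℝ (Rn n) (Rn n) ∘L
        ContinuousLinearMap.snd ℝ ℝ (Rn n × Rn n)).hasFDerivAt).prodMk (D.differentiableAt_force hy).hasFDerivAt)
  rw [h.fderiv]
  rfl

theorem theta_fderiv_H (hy : y ∈ S) (a b : Fin n) (v : Coord n) :
    theta a y (fderiv ℝ (H f b) y v) = 0 := by
  have hd := (D.differentiableAt_H b hy).hasFDerivAt
  have h1 := (hd.fst.congr_of_eventuallyEq
    (Filter.Eventually.of_forall fun z => (H_fst (f := f) b z).symm)).unique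
    (hasFDerivAt_const (0 : ℝ) y)
  have h2 := (hd.snd.fst.congr_of_eventuallyEq
    (Filter.Eventually.of_forall fun z => (H_snd_fst (f := f) b z).symm)).unique
    (hasFDerivAt_const (EuclideanSpace.single b (1 : ℝ)) y)
  have h1' : (fderiv ℝ (H f b) y v).1 = 0 := congrArg (fun T : Coord n →L[ℝ] ℝ => T v) h1
  have h2' : (fderiv ℝ (H f b) y v).2.1 = 0 := congrArg (fun T : Coord n →L[ℝ] Rn n => T v) h2
  simp [h1', h2']

theorem covForm_spray_left (hy : y ∈ S) (X Z : VField n) :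
    covForm f Ω X (spray f) Z y = 0 := by
  have h : (fun z => Ω z ![spray f z, Z z]) =ᶠ[𝓝 y] fun _ => (0 : ℝ) := by
    filter_upwards [D.isOpen.mem_nhds hy] with z hz using D.form_spray_left hz _
  rw [covForm, h.fderiv_eq, cov_spray, D.form_spray_left hy, ← toBilin_apply]
  simp

theorem covForm_V_V (hy : y ∈ S) (X : VField n) (a b : Fin n) :
    covForm f Ω X (V a) (V b) y = 0 := by
  have h : (fun z => Ω z ![V a z, V b z]) =ᶠ[𝓝 y] fun _ => (0 : ℝ) := by
    filter_upwards [D.isOpen.mem_nhds hy] with z hz using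
      D.form_eq_zero_of_theta hz (fun c => theta_du c a z) (fun c => theta_du c b z)
  rw [covForm, h.fderiv_eq,
    D.form_eq_zero_of_theta hy (fun c => theta_cov_V X c a y) (fun c => theta_V c b y),
    D.form_eq_zero_of_theta hy (fun c => theta_V c a y) (fun c => theta_cov_V X c b y)]
  simp

theorem covForm_H_H (hy : y ∈ S) (X : VField n) (a b : Fin n) :
    covForm f Ω X (H f a) (H f b) y = 0 := by
  have h : (fun z => Ω z ![H f a z, H f b z]) =ᶠ[𝓝 y] fun _ => (0 : ℝ) := by
    filter_upwards [D.isOpen.mem_nhds hy] with z hz using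
      D.form_eq_zero_of_psi hz (fun c => psi_H c a z) (fun c => psi_H c b z)
  rw [covForm, h.fderiv_eq,
    D.form_eq_zero_of_psi hy (fun c => psi_cov_H X c a y) (fun c => psi_H c b y),
    D.form_eq_zero_of_psi hy (fun c => psi_H c a y) (fun c => psi_cov_H X c b y)]
  simp

theorem Xi_spray (hy : y ∈ S) (Y Z : VField n) :
    Xi f Ω (spray f) Y Z y = -covForm f Ω (spray f) Y Z y := by
  rw [Xi, D.covForm_spray_left hy, D.covForm_spray_left hy]
  ring

/-- `T(Γ, V_a)` is horizontal; in fact it is `H_a`. -/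
theorem psi_torsion_spray_V (hy : y ∈ S) (a c : Fin n) :
    psi f c y (torsion f (spray f) (V a) y) = 0 := by
  have h2 : fderiv ℝ f y (du a) c = -2 * connCoeff f c a y := by
    have h := ((EuclideanSpace.proj (𝕜 := ℝ) c).hasFDerivAt.comp y
      (D.differentiableAt_force hy).hasFDerivAt).fderiv
    have h' : fderiv ℝ (fun z => f z c) y (du a) = fderiv ℝ f y (du a) c :=
      congrArg (fun T : Coord n →L[ℝ] ℝ => T (du a)) h
    rw [connCoeff, h']; ring
  rw [torsion, cov_spray, VectorField.lieBracket_eq]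
  beta_reduce
  rw [fderiv_V, D.fderiv_spray_apply hy, cov_V, show V a y = du a from rfl, map_sub, map_sub, map_sub, map_sum]
  simp only [map_smul, psi_du, connForm_spray]
  simp [h2]
  simp [du]
  ring

theorem theta_torsion_spray_H (hy : y ∈ S) (b c : Fin n) :
    theta c y (torsion f (spray f) (H f b) y) = 0 := by
  rw [torsion, cov_spray, VectorField.lieBracket_eq, cov_H]
  simp only [map_sub, D.theta_fderiv_H hy, D.fderiv_spray_apply hy, map_sum, map_smul, theta_H,
    connForm_spray]
  simp [H_snd_snd]

theorem theta_torsion_V_H (hy : y ∈ S) (a b c : Fin n) :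
    theta c y (torsion f (V a) (H f b) y) = 0 := by
  rw [torsion, map_sub, map_sub, theta_cov_V, cov_H, VectorField.lieBracket_eq]
  beta_reduce
  rw [map_sub, D.theta_fderiv_H hy, fderiv_V]
  simp [V, connForm_du]

theorem TForm_spray_V_H (hy : y ∈ S) (a b : Fin n) :
    TForm f Ω (spray f) (V a) (H f b) y = 0 := by
  rw [TForm, alt_two_swap _ (torsion f (V a) (H f b) y), D.form_spray_left hy,
    D.form_eq_zero_of_psi hy (fun c => D.psi_torsion_spray_V hy a c) (fun c => psi_H c b y),
    D.form_eq_zero_of_theta hy (fun c => D.theta_torsion_spray_H hy b c)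
      (fun c => theta_V c a y)]
  simp

theorem TForm_V_V_H (hy : y ∈ S) (a b c : Fin n) :
    TForm f Ω (V a) (V b) (H f c) y = 0 := by
  rw [TForm, torsion_V_V,
    D.form_eq_zero_of_theta hy (fun k => D.theta_torsion_V_H hy a c k)
      (fun k => theta_V k b y),
    D.form_eq_zero_of_theta hy (fun k => D.theta_torsion_V_H hy b c k)
      (fun k => theta_V k a y), ← toBilin_apply]
  simp

/-! ### The component conditions in terms of the exterior derivative -/

theorem TForm_spray_V_V (hy : y ∈ S) (a b : Fin n) :
    TForm f Ω (spray f) (V a) (V b) y = extDeriv Ω y ![spray f y, du a, du b] := by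
  have h := extDeriv_eq_TForm_sub_Xi (f := f) (D.differentiableAt_form hy)
    (D.differentiableAt_spray hy) (differentiableAt_const (du a)) (differentiableAt_const (du b))
  have h' := (D.Xi_spray hy (V a) (V b)).trans (by rw [D.covForm_V_V hy, neg_zero])
  exact ((h.trans (congrArg _ h')).trans (sub_zero _)).symm

theorem TForm_spray_H_H (hy : y ∈ S) (a b : Fin n) :
    TForm f Ω (spray f) (H f a) (H f b) y = extDeriv Ω y ![spray f y, H f a y, H f b y] := by
  rw [extDeriv_eq_TForm_sub_Xi (f := f) (D.differentiableAt_form hy)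
    (D.differentiableAt_spray hy) (D.differentiableAt_H a hy) (D.differentiableAt_H b hy),
    D.Xi_spray hy, D.covForm_H_H hy, neg_zero, sub_zero]

theorem Xi_spray_V_H (hy : y ∈ S) (a b : Fin n) :
    Xi f Ω (spray f) (V a) (H f b) y = -extDeriv Ω y ![spray f y, du a, H f b y] := by
  have h := extDeriv_eq_TForm_sub_Xi (f := f) (D.differentiableAt_form hy)
    (D.differentiableAt_spray hy) (differentiableAt_const (du a)) (D.differentiableAt_H b hy)
  rw [h]
  change _ = -(TForm f Ω (spray f) (V a) (H f b) y - Xi f Ω (spray f) (V a) (H f b) y)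
  rw [D.TForm_spray_V_H hy]
  ring

theorem Xi_V_V_H (hy : y ∈ S) (a b c : Fin n) :
    Xi f Ω (V a) (V b) (H f c) y = -extDeriv Ω y ![du a, du b, H f c y] := by
  have h := extDeriv_eq_TForm_sub_Xi (f := f) (D.differentiableAt_form hy)
    (differentiableAt_const (du a)) (differentiableAt_const (du b)) (D.differentiableAt_H c hy)
  rw [h]
  change _ = -(TForm f Ω (V a) (V b) (H f c) y - Xi f Ω (V a) (V b) (H f c) y)
  rw [D.TForm_V_V_H hy]
  ring

end MultiplierData

end Evolution
end CoordinateTheory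

/-! ### Closedness of the 2-form -/

section Trilinear

set_option maxSynthPendingDepth 3

variable {E : Type*} [NormedAddCommGroup E] [NormedSpace ℝ E]

/-- An alternating 3-form as a trilinear form. -/
noncomputable def toTrilin : (E [⋀^Fin 3]→L[ℝ] ℝ) →L[ℝ] (E →L[ℝ] E →L[ℝ] E →L[ℝ] ℝ) :=
  (ContinuousLinearMap.compL ℝ E (E [⋀^Fin 2]→L[ℝ] ℝ) (E →L[ℝ] E →L[ℝ] ℝ) toBilin) ∘L
    (ContinuousAlternatingMap.curryLeftLI (𝕜 := ℝ) (E := E) (F := ℝ)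
      (n := 2)).toContinuousLinearMap

theorem toTrilin_apply (η : E [⋀^Fin 3]→L[ℝ] ℝ) (X Y Z : E) :
    toTrilin η X Y Z = η ![X, Y, Z] := by
  change toBilin (η.curryLeft X) Y Z = _
  rw [toBilin_apply]
  rfl

theorem contDiff_toTrilin {k : WithTop ℕ∞} :
    ContDiff ℝ k (fun η : E [⋀^Fin 3]→L[ℝ] ℝ => toTrilin η) :=
  ContinuousLinearMap.contDiff _

theorem toTrilin_swap_left (η : E [⋀^Fin 3]→L[ℝ] ℝ) (X Y Z : E) :
    toTrilin η X Y Z = -toTrilin η Y X Z := by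
  have h := η.toAlternatingMap.map_swap ![Y, X, Z] (i := 0) (j := 1) (by decide)
  rw [toTrilin_apply, toTrilin_apply, ← ContinuousAlternatingMap.coe_toAlternatingMap, ← h]
  congr 1
  funext i
  fin_cases i <;> rfl

theorem toTrilin_swap_right (η : E [⋀^Fin 3]→L[ℝ] ℝ) (X Y Z : E) :
    toTrilin η X Y Z = -toTrilin η X Z Y := by
  have h := η.toAlternatingMap.map_swap ![X, Z, Y] (i := 1) (j := 2) (by decide)
  rw [toTrilin_apply, toTrilin_apply, ← ContinuousAlternatingMap.coe_toAlternatingMap, ← h]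
  congr 1
  funext i
  fin_cases i <;> rfl

theorem toTrilin_self_left (η : E [⋀^Fin 3]→L[ℝ] ℝ) (X Z : E) : toTrilin η X X Z = 0 := by
  linarith [toTrilin_swap_left η X X Z]

theorem extDeriv_three_apply {Θ : E → E [⋀^Fin 3]→L[ℝ] ℝ} {y : E} (h : DifferentiableAt ℝ Θ y)
    (W X Y Z : E) : extDeriv Θ y ![W, X, Y, Z] = fderiv ℝ (fun z => toTrilin (Θ z) X Y Z) y W
      - fderiv ℝ (fun z => toTrilin (Θ z) W Y Z) y X
      + fderiv ℝ (fun z => toTrilin (Θ z) W X Z) y Y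
      - fderiv ℝ (fun z => toTrilin (Θ z) W X Y) y Z := by
  have h1 : Fin.removeNth 1 ![W, X, Y, Z] = ![W, Y, Z] := by
    funext i; fin_cases i <;> rfl
  have h2 : Fin.removeNth 2 ![W, X, Y, Z] = ![W, X, Z] := by
    funext i; fin_cases i <;> rfl
  have h3 : Fin.removeNth 3 ![W, X, Y, Z] = ![W, X, Y] := by
    funext i; fin_cases i <;> rfl
  rw [extDeriv_apply h]
  simp [Fin.sum_univ_four, h1, h2, h3, toTrilin_apply, sub_eq_add_neg, pow_succ]

theorem ContDiffOn.extDeriv {p : ℕ} {Ω : E → E [⋀^Fin p]→L[ℝ] ℝ} {S : Set E} (hS : IsOpen S)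
    (h : ContDiffOn ℝ ∞ Ω S) : ContDiffOn ℝ ∞ (extDeriv Ω) S := by
  have hA : ContDiff ℝ ∞ (ContinuousAlternatingMap.alternatizeUncurryFinCLM ℝ E ℝ (n := p)) :=
    ContinuousLinearMap.contDiff _
  exact hA.comp_contDiffOn ((contDiffOn_infty_iff_fderiv_of_isOpen hS).1 h).2

/-- A closed 3-form annihilated by a vector field `G` is invariant under the flow of `G`: its Lie
derivative, here evaluated on constant vectors, vanishes. -/
theorem lieDeriv_eq_zero {Θ : E → E [⋀^Fin 3]→L[ℝ] ℝ} {G : E → E} {y : E}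
    (hΘ : DifferentiableAt ℝ Θ y) (hG : DifferentiableAt ℝ G y) (hclosed : extDeriv Θ y = 0)
    (hzero : ∀ᶠ z in 𝓝 y, toTrilin (Θ z) (G z) = 0) (X Y Z : E) :
    fderiv ℝ (fun z => toTrilin (Θ z) X Y Z) y (G y) + toTrilin (Θ y) (fderiv ℝ G y X) Y Z
      - toTrilin (Θ y) (fderiv ℝ G y Y) X Z + toTrilin (Θ y) (fderiv ℝ G y Z) X Y = 0 := by
  have hT : DifferentiableAt ℝ (fun z => toTrilin (Θ z)) y :=
    (contDiff_toTrilin.differentiable one_ne_zero).differentiableAt.comp y hΘ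
  -- differentiate `Θ(G, V, W) = 0`
  have key : ∀ U V W : E, fderiv ℝ (fun z => toTrilin (Θ z) (G y) V W) y U =
      -toTrilin (Θ y) (fderiv ℝ G y U) V W := fun U V W => by
    have h1 := ((hT.hasFDerivAt.clm_apply hG.hasFDerivAt).clm_apply
      (hasFDerivAt_const V y)).clm_apply (hasFDerivAt_const W y)
    have h2 := ((hT.hasFDerivAt.clm_apply (hasFDerivAt_const (G y) y)).clm_apply
      (hasFDerivAt_const V y)).clm_apply (hasFDerivAt_const W y)
    have h3 : (fun z => toTrilin (Θ z) (G z) V W) =ᶠ[𝓝 y] fun _ => (0 : ℝ) := by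
      filter_upwards [hzero] with z hz
      rw [hz]; rfl
    have h4 := congrArg (fun T : E →L[ℝ] ℝ => T U)
      (h1.unique ((hasFDerivAt_const (0 : ℝ) y).congr_of_eventuallyEq h3))
    rw [h2.fderiv]
    simp only [ContinuousLinearMap.comp_zero, zero_add, _root_.add_apply,
      ContinuousLinearMap.flip_apply, ContinuousLinearMap.comp_apply, _root_.zero_apply] at h4 ⊢
    linarith
  have h := congrArg (fun η => η ![G y, X, Y, Z]) hclosed
  simp only [extDeriv_three_apply hΘ, key] at h
  linarith [h.trans (rfl : _ = (0 : ℝ))]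

end Trilinear

theorem minSmoothness_two_le_infty : minSmoothness ℝ 2 ≤ (∞ : WithTop ℕ∞) := by
  rw [minSmoothness_of_isRCLikeNormedField]
  exact WithTop.coe_le_coe.2 (le_top : (2 : ℕ∞) ≤ ⊤)

section CoordinateTheory

set_option maxSynthPendingDepth 3

namespace Evolution

variable {n : ℕ} {f : Coord n → Rn n} {g : Fin n → Fin n → Coord n → ℝ} {Ω : Form n 2}
  {S : Set (Coord n)} {y : Coord n}

theorem vert_eq_sum (w : Rn n) : ((0, (0, w)) : Coord n) = ∑ a, w a • du a := by
  refine Prod.ext (by simp [du, Prod.fst_sum])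
    (Prod.ext (by simp [du, Prod.fst_sum, Prod.snd_sum]) ?_)
  ext b
  simp [du, Prod.snd_sum, Pi.single_apply]

theorem hor_eq_sum (w : Rn n) : ((0, (w, 0)) : Coord n) = ∑ a, w a • dx a := by
  refine Prod.ext (by simp [dx, Prod.fst_sum]) (Prod.ext ?_ (by simp [dx, Prod.snd_sum]))
  ext b
  simp [dx, Prod.fst_sum, Prod.snd_sum, Pi.single_apply]

section

variable {G : Type*} [NormedAddCommGroup G] [NormedSpace ℝ G]

theorem clm_vert_eq_zero {l : Coord n →L[ℝ] G} (h : ∀ a, l (du a) = 0) (w : Rn n) :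
    l (0, (0, w)) = 0 := by
  rw [vert_eq_sum, map_sum]
  exact Finset.sum_eq_zero fun a _ => by rw [map_smul, h, smul_zero]

/-- The vectors `Γ`, `∂/∂x^a` and `∂/∂u^a` span the tangent space. -/
theorem clm_ext_dx {l : Coord n →L[ℝ] G} (h₀ : l (spray f y) = 0) (h₁ : ∀ a, l (dx a) = 0)
    (h₂ : ∀ a, l (du a) = 0) : l = 0 := by
  refine ContinuousLinearMap.ext fun v => ?_
  have hv : v = v.1 • spray f y + ((0, (v.2.1 - v.1 • y.2.2, 0)) : Coord n)
      + (0, (0, v.2.2 - v.1 • f y)) := by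
    refine Prod.ext ?_ (Prod.ext ?_ ?_) <;> simp [spray]
  rw [hv, map_add, map_add, map_smul, h₀, clm_vert_eq_zero h₂, hor_eq_sum, map_sum,
    Finset.sum_eq_zero fun a _ => by rw [map_smul, h₁, smul_zero]]
  simp

/-- The vectors `Γ`, `H_a` and `V_a` span the tangent space. -/
theorem clm_ext_H {l : Coord n →L[ℝ] G} (h₀ : l (spray f y) = 0) (h₁ : ∀ a, l (H f a y) = 0)
    (h₂ : ∀ a, l (du a) = 0) : l = 0 := by
  refine clm_ext_dx h₀ (fun a => ?_) h₂
  have h := h₁ a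
  rw [H, map_sub, map_sum, Finset.sum_eq_zero fun b _ => by rw [map_smul, h₂, smul_zero],
    sub_zero] at h
  exact h

end

namespace MultiplierData

variable (D : MultiplierData f g Ω S)
include D

theorem extDeriv_V_V_V (hy : y ∈ S) (a b c : Fin n) :
    extDeriv Ω y ![du a, du b, du c] = 0 := by
  have h : ∀ a b : Fin n, fderiv ℝ (fun z => Ω z ![du a, du b]) y = 0 := fun a b => by
    have h : (fun z => Ω z ![du a, du b]) =ᶠ[𝓝 y] fun _ => (0 : ℝ) := by
      filter_upwards [D.isOpen.mem_nhds hy] with z hz using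
        D.form_eq_zero_of_theta hz (fun c => theta_du c a z) (fun c => theta_du c b z)
    rw [h.fderiv_eq]; simp
  rw [extDeriv_two_apply (D.differentiableAt_form hy), h, h, h]
  simp

/-- If the components of `dΩ` on `(Γ, V, V)`, `(Γ, H, H)`, `(Γ, V, H)` and `(V, V, H)` vanish, then
`Ω` is closed: the components on `(V, H, H)` and `(H, H, H)` are obtained from the vanishing ones
by differentiating along `Γ`, since `dΩ` is invariant under the flow of `Γ`. -/
theorem extDeriv_eq_zero
    (h₁ : ∀ y ∈ S, ∀ a b, extDeriv Ω y ![spray f y, du a, du b] = 0)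
    (h₂ : ∀ y ∈ S, ∀ a b, extDeriv Ω y ![spray f y, H f a y, H f b y] = 0)
    (h₃ : ∀ y ∈ S, ∀ a b, extDeriv Ω y ![spray f y, du a, H f b y] = 0)
    (h₄ : ∀ y ∈ S, ∀ a b c, extDeriv Ω y ![du a, du b, H f c y] = 0) (hy : y ∈ S) :
    extDeriv Ω y = 0 := by
  replace h₁ := fun y hy a b => (toTrilin_apply _ _ _ _).trans (h₁ y hy a b)
  replace h₂ := fun y hy a b => (toTrilin_apply _ _ _ _).trans (h₂ y hy a b)
  replace h₃ := fun y hy a b => (toTrilin_apply _ _ _ _).trans (h₃ y hy a b)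
  replace h₄ := fun y hy a b c => (toTrilin_apply _ _ _ _).trans (h₄ y hy a b c)
  have hsp : ∀ y ∈ S, toTrilin (extDeriv Ω y) (spray f y) = 0 := fun y hy => by
    refine clm_ext_H (f := f) (y := y) ?_ (fun a => ?_) (fun a => ?_)
    · exact ContinuousLinearMap.ext fun Z => toTrilin_self_left _ _ _
    · exact clm_ext_H (f := f) (y := y) (by rw [toTrilin_swap_right, toTrilin_self_left, neg_zero])
        (fun b => h₂ y hy a b) (fun b => by rw [toTrilin_swap_right, h₃ y hy, neg_zero])
    · exact clm_ext_H (f := f) (y := y) (by rw [toTrilin_swap_right, toTrilin_self_left, neg_zero])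
        (fun b => h₃ y hy a b) (fun b => h₁ y hy a b)
  have hvv : ∀ y ∈ S, ∀ a b, toTrilin (extDeriv Ω y) (du a) (du b) = 0 := fun y hy a b => by
    refine clm_ext_H (f := f) (y := y) ?_ (fun c => h₄ y hy a b c) (fun c => ?_)
    · rw [toTrilin_swap_right, toTrilin_swap_left, hsp y hy]; simp
    · exact (toTrilin_apply _ _ _ _).trans (D.extDeriv_V_V_V hy a b c)
  have hΩ2 : ∀ y ∈ S, extDeriv (extDeriv Ω) y = 0 := fun y hy =>
    extDeriv_extDeriv_apply (D.contDiffOn_form.contDiffAt (D.isOpen.mem_nhds hy))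
      minSmoothness_two_le_infty
  have hΘ : ∀ y ∈ S, DifferentiableAt ℝ (extDeriv Ω) y := fun y hy =>
    ((D.contDiffOn_form.extDeriv D.isOpen).differentiableOn (by simp)).differentiableAt
      (D.isOpen.mem_nhds hy)
  have hlie : ∀ y ∈ S, ∀ X Y Z : Coord n, (∀ z ∈ S, toTrilin (extDeriv Ω z) X Y Z = 0) →
      toTrilin (extDeriv Ω y) (fderiv ℝ (spray f) y X) Y Z
      - toTrilin (extDeriv Ω y) (fderiv ℝ (spray f) y Y) X Z
      + toTrilin (extDeriv Ω y) (fderiv ℝ (spray f) y Z) X Y = 0 := fun y hy X Y Z h => by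
    have h1 := lieDeriv_eq_zero (hΘ y hy) (D.differentiableAt_spray hy) (hΩ2 y hy)
      (by filter_upwards [D.isOpen.mem_nhds hy] with z hz using hsp z hz) X Y Z
    have h2 : (fun z => toTrilin (extDeriv Ω z) X Y Z) =ᶠ[𝓝 y] fun _ => (0 : ℝ) := by
      filter_upwards [D.isOpen.mem_nhds hy] with z hz using h z hz
    rw [h2.fderiv_eq] at h1
    simpa using h1
  have hdu : ∀ y ∈ S, ∀ a, fderiv ℝ (spray f) y (du a) =
      dx a + (0, (0, fderiv ℝ f y (du a))) := fun y hy a => by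
    rw [D.fderiv_spray_apply hy]
    simp [dx, du]
  have hdx : ∀ y ∈ S, ∀ a, fderiv ℝ (spray f) y (dx a) =
      (0, (0, fderiv ℝ f y (dx a))) := fun y hy a => by
    rw [D.fderiv_spray_apply hy]
    simp [dx]
  have hvert : ∀ y ∈ S, ∀ w b, toTrilin (extDeriv Ω y) (0, (0, w)) (du b) = 0 :=
    fun y hy w b => by
      have h := clm_vert_eq_zero (l := (toTrilin (extDeriv Ω y)).flip (du b))
        (fun a => hvv y hy a b) w
      exact h
  -- the invariance along `Γ`, applied to `(V, V, H)`
  have hsym : ∀ y ∈ S, ∀ a b c, toTrilin (extDeriv Ω y) (du a) (dx b) (dx c) =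
      toTrilin (extDeriv Ω y) (du b) (dx a) (dx c) := fun y hy a b c => by
    have h := hlie y hy (du a) (du b) (dx c) (fun z hz => by rw [hvv z hz]; rfl)
    rw [hdu y hy, hdu y hy, hdx y hy, map_add, map_add] at h
    simp only [_root_.add_apply, hvert y hy, _root_.zero_apply, add_zero] at h
    rw [toTrilin_swap_left _ (dx a), toTrilin_swap_left _ (dx b)] at h
    linarith
  have hvhh : ∀ y ∈ S, ∀ a b c, toTrilin (extDeriv Ω y) (du a) (dx b) (dx c) = 0 :=
    fun y hy a b c => by
      -- symmetric in the first two indices and antisymmetric in the last two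
      linarith [hsym y hy a b c, toTrilin_swap_right (extDeriv Ω y) (du b) (dx a) (dx c),
        hsym y hy b c a, toTrilin_swap_right (extDeriv Ω y) (du c) (dx b) (dx a),
        hsym y hy c a b, toTrilin_swap_right (extDeriv Ω y) (du a) (dx c) (dx b)]
  -- the invariance along `Γ`, applied to `(V, H, H)`
  have hhhh : ∀ a b c, toTrilin (extDeriv Ω y) (dx a) (dx b) (dx c) = 0 := fun a b c => by
    have h := hlie y hy (du a) (dx b) (dx c) (fun z hz => hvhh z hz a b c)
    have hv : ∀ w, toTrilin (extDeriv Ω y) (0, (0, w)) (dx b) (dx c) = 0 := fun w =>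
      clm_vert_eq_zero (l := ((toTrilin (extDeriv Ω y)).flip (dx b)).flip (dx c))
        (fun a => hvhh y hy a b c) w
    rw [hdu y hy, hdx y hy, hdx y hy, map_add] at h
    simp only [_root_.add_apply, hvert y hy, hv, _root_.zero_apply, add_zero, sub_zero] at h
    exact h
  have hT : toTrilin (extDeriv Ω y) = 0 := by
    refine clm_ext_dx (hsp y hy) (fun a => ?_) (fun a => ?_)
    · refine clm_ext_dx (f := f) (y := y) ?_ (fun b => ?_) (fun b => ?_)
      · exact ContinuousLinearMap.ext fun Z => by rw [toTrilin_swap_left, hsp y hy]; simp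
      · refine clm_ext_dx (f := f) (y := y) ?_ (fun c => hhhh a b c) (fun c => ?_)
        · rw [toTrilin_swap_right, toTrilin_swap_left, hsp y hy]; simp
        · rw [toTrilin_swap_right, toTrilin_swap_left, hvhh y hy]; simp
      · refine clm_ext_dx (f := f) (y := y) ?_ (fun c => ?_) (fun c => ?_)
        · rw [toTrilin_swap_right, toTrilin_swap_left, hsp y hy]; simp
        · rw [toTrilin_swap_left, hvhh y hy]; simp
        · rw [toTrilin_swap_left, toTrilin_swap_right, hvv y hy]; simp
    · refine clm_ext_dx (f := f) (y := y) ?_ (fun b => ?_) (fun b => hvv y hy a b)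
      · exact ContinuousLinearMap.ext fun Z => by rw [toTrilin_swap_left, hsp y hy]; simp
      · refine clm_ext_dx (f := f) (y := y) ?_ (fun c => hvhh y hy a b c) (fun c => ?_)
        · rw [toTrilin_swap_right, toTrilin_swap_left, hsp y hy]; simp
        · rw [toTrilin_swap_right, hvv y hy]; simp
  ext v
  have hv : v = ![v 0, v 1, v 2] := by funext i; fin_cases i <;> rfl
  rw [hv]
  refine (toTrilin_apply _ _ _ _).symm.trans ?_
  rw [hT]
  rfl

end MultiplierData

end Evolution
end CoordinateTheory

/-! ### Rank and regularity -/

section Rank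

open Module

variable {E : Type*} [NormedAddCommGroup E] [NormedSpace ℝ E]

/-- In dimension `2n + 1` a 2-form with a nonzero null vector `G` has rank `2n` if and only if its
kernel is the line spanned by `G`. -/
theorem finrank_range_curryLeft_iff [FiniteDimensional ℝ E] {n : ℕ} (hE : finrank ℝ E = 2 * n + 1)
    (η : E [⋀^Fin 2]→L[ℝ] ℝ) {G : E} (hG₀ : G ≠ 0) (hG : ∀ Y, η ![G, Y] = 0) :
    finrank ℝ (LinearMap.range η.toAlternatingMap.curryLeft) = 2 * n ↔
      ∀ X, (∀ Y, η ![X, Y] = 0) → ∃ c : ℝ, c • G = X := by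
  have hker : ∀ X, X ∈ LinearMap.ker η.toAlternatingMap.curryLeft ↔ ∀ Y, η ![X, Y] = 0 := by
    intro X
    rw [LinearMap.mem_ker]
    constructor
    · intro h Y
      exact congrArg (fun T => T ![Y]) h
    · intro h
      ext v
      have hv : v = ![v 0] := by funext i; fin_cases i; rfl
      rw [hv]
      exact h (v 0)
  have hsum := LinearMap.finrank_range_add_finrank_ker η.toAlternatingMap.curryLeft
  rw [hE] at hsum
  have h1 : finrank ℝ (LinearMap.range η.toAlternatingMap.curryLeft) = 2 * n ↔
      finrank ℝ (LinearMap.ker η.toAlternatingMap.curryLeft) = 1 := by omega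
  have hne : (⟨G, (hker G).2 hG⟩ : LinearMap.ker η.toAlternatingMap.curryLeft) ≠ 0 :=
    fun h => hG₀ (congrArg Subtype.val h)
  rw [h1, finrank_eq_one_iff_of_nonzero' _ hne]
  constructor
  · intro h X hX
    obtain ⟨c, hc⟩ := h ⟨X, (hker X).2 hX⟩
    exact ⟨c, congrArg Subtype.val hc⟩
  · rintro h ⟨X, hX⟩
    obtain ⟨c, hc⟩ := h X ((hker X).1 hX)
    exact ⟨c, Subtype.ext hc⟩

end Rank

section CoordinateTheory

set_option maxSynthPendingDepth 3

namespace Evolution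

variable {n : ℕ} {f : Coord n → Rn n} {g : Fin n → Fin n → Coord n → ℝ} {Ω : Form n 2}
  {S : Set (Coord n)} {y : Coord n}

theorem eq_smul_spray {X : Coord n} (hθ : ∀ a, theta a y X = 0) (hψ : ∀ a, psi f a y X = 0) :
    X.1 • spray f y = X := by
  refine Prod.ext (by simp [spray]) (Prod.ext ?_ ?_)
  · ext a
    have := hθ a
    rw [theta_apply] at this
    simp only [spray, Prod.smul_fst, Prod.smul_snd, PiLp.smul_apply, smul_eq_mul]
    linarith
  · ext a
    have := hψ a
    rw [psi_apply, Finset.sum_eq_zero fun b _ => by rw [hθ, mul_zero]] at this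
    simp only [spray, Prod.smul_snd, PiLp.smul_apply, smul_eq_mul]
    linarith

theorem MultiplierData.form_H (D : MultiplierData f g Ω S) (hy : y ∈ S) (X : Coord n)
    (b : Fin n) : Ω y ![X, H f b y] = ∑ a, psi f a y X * g a b y := by
  rw [D.form y hy]
  simp only [theta_H, psi_H]
  simp [mul_comm]

theorem MultiplierData.form_du (D : MultiplierData f g Ω S) (hy : y ∈ S) (X : Coord n)
    (a : Fin n) : Ω y ![X, du a] = -∑ b, g a b y * theta b y X := by
  rw [D.form y hy]
  simp only [theta_du, psi_du]
  simp [ite_mul]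

/-- The kernel of `Ω = g_ab ψ^a ∧ θ^b` is spanned by the semispray if and only if the matrix
`(g_ab)` is invertible. -/
theorem MultiplierData.ker_iff_det_ne_zero (D : MultiplierData f g Ω S) (hy : y ∈ S) :
    (∀ X, (∀ Y, Ω y ![X, Y] = 0) → ∃ c : ℝ, c • spray f y = X) ↔
      (Matrix.of fun a b => g a b y).det ≠ 0 := by
  constructor
  · intro h hdet
    -- a null vector `w` of `g` gives the horizontal null vector `w^b H_b` of `Ω`
    obtain ⟨w, hw, hgw⟩ := Matrix.exists_mulVec_eq_zero_iff.2 hdet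
    have hθ : ∀ a, theta a y (∑ b, w b • H f b y) = w a := fun a => by
      rw [map_sum]
      simp only [map_smul, theta_H]
      simp
    have hψ : ∀ a, psi f a y (∑ b, w b • H f b y) = 0 := fun a => by
      rw [map_sum]
      exact Finset.sum_eq_zero fun b _ => by rw [map_smul, psi_H, smul_zero]
    obtain ⟨c, hc⟩ := h (∑ b, w b • H f b y) fun Y => by
      rw [D.form y hy]
      simp only [hθ, hψ, zero_mul, zero_sub]
      refine Finset.sum_eq_zero fun a _ => ?_
      have := congrFun hgw a
      simp only [Matrix.mulVec, dotProduct, Matrix.of_apply, Pi.zero_apply] at this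
      calc ∑ b, g a b y * -(psi f a y Y * w b) = -psi f a y Y * ∑ b, g a b y * w b := by
            rw [Finset.mul_sum]; exact Finset.sum_congr rfl fun b _ => by ring
        _ = 0 := by rw [this, mul_zero]
    refine hw (funext fun a => ?_)
    rw [← hθ a, ← hc, map_smul, theta_spray, smul_zero]
    rfl
  · intro hdet X hX
    refine ⟨X.1, eq_smul_spray (fun a => ?_) (fun a => ?_)⟩
    · have := Matrix.eq_zero_of_mulVec_eq_zero hdet (v := fun b => theta b y X) (funext fun a => by
        have := hX (du a)
        rw [D.form_du hy, neg_eq_zero] at this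
        exact this)
      exact congrFun this a
    · have := Matrix.eq_zero_of_vecMul_eq_zero hdet (v := fun b => psi f b y X) (funext fun b => by
        have := hX (H f b y)
        rw [D.form_H hy] at this
        exact this)
      exact congrFun this a

/-! ### Construction of the Lagrangian in natural coordinates -/

/-- The Cartan form as a field of covectors. -/
noncomputable def cartanCLM (L : Coord n → ℝ) (y : Coord n) : Coord n →L[ℝ] ℝ :=
  L y • formT + ∑ a, fderiv ℝ L y (du a) • theta a y

theorem cartan_eq (L : Coord n → ℝ) : cartan L = fun y =>
    ContinuousAlternatingMap.ofSubsingleton ℝ (Coord n) ℝ (0 : Fin 1) (cartanCLM L y) := rfl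

theorem cartanCLM_du (L : Coord n → ℝ) (y : Coord n) (b : Fin n) : cartanCLM L y (du b) = 0 := by
  simp only [cartanCLM, _root_.add_apply, _root_.smul_apply, _root_.sum_apply, theta_du]
  simp [du]

theorem cartanCLM_dx (L : Coord n → ℝ) (y : Coord n) (b : Fin n) :
    cartanCLM L y (dx b) = fderiv ℝ L y (du b) := by
  have h : ∀ c, theta c y (dx b) = if c = b then 1 else 0 := fun c => by simp [dx]
  simp only [cartanCLM, _root_.add_apply, _root_.smul_apply, _root_.sum_apply, h]
  simp [dx]

theorem cartanCLM_spray (L : Coord n → ℝ) (y : Coord n) : cartanCLM L y (spray f y) = L y := by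
  simp only [cartanCLM, _root_.add_apply, _root_.smul_apply, _root_.sum_apply, theta_spray]
  simp [spray]

theorem contDiffOn_cartanCLM {L : Coord n → ℝ} (hS : IsOpen S) (hL : ContDiffOn ℝ ∞ L S) :
    ContDiffOn ℝ ∞ (cartanCLM L) S := by
  have h : ∀ a, ContDiffOn ℝ ∞ (fun z => fderiv ℝ L z (du a)) S := fun a =>
    ((contDiffOn_infty_iff_fderiv_of_isOpen hS).1 hL).2.clm_apply contDiffOn_const
  exact (hL.smul contDiffOn_const).add (ContDiffOn.sum fun a _ =>
    (h a).smul (MultiplierData.contDiff_theta a).contDiffOn)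

theorem contDiffOn_cartan {L : Coord n → ℝ} (hS : IsOpen S) (hL : ContDiffOn ℝ ∞ L S) :
    ContDiffOn ℝ ∞ (cartan L) S :=
  (ContinuousAlternatingMap.ofSubsingletonLIE (𝕜 := ℝ) (E := Coord n) (F := ℝ)
    (0 : Fin 1)).contDiff.comp_contDiffOn (contDiffOn_cartanCLM hS hL)

theorem extDeriv_cartan_du_dx {L : Coord n → ℝ} (h : DifferentiableAt ℝ (cartanCLM L) y)
    (a b : Fin n) : extDeriv (cartan L) y ![du a, dx b] = hessian L y a b := by
  have e : ∀ X Z : Coord n, fderiv ℝ (cartanCLM L) y X Z =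
      fderiv ℝ (fun z => cartanCLM L z Z) y X := fun X Z => by
    rw [fderiv_clm_apply h (differentiableAt_const _)]
    simp
  rw [cartan_eq, extDeriv_one_apply h, e, e]
  simp only [cartanCLM_du, cartanCLM_dx]
  simp [hessian]

/-- A covector field vanishing on `∂/∂u^a`, whose exterior derivative vanishes on the pairs
`(∂/∂u^a, ∂/∂t + u^b ∂/∂x^b)`, is the Cartan form of its value on `∂/∂t + u^b ∂/∂x^b`. -/
theorem eq_cartanCLM {α : Coord n → Coord n →L[ℝ] ℝ} (hα : DifferentiableAt ℝ α y)
    (hv : ∀ᶠ z in 𝓝 y, ∀ a, α z (du a) = 0)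
    (hd : ∀ a, fderiv ℝ α y (du a) (spray 0 y) - fderiv ℝ α y (spray 0 y) (du a) = 0) :
    α y = cartanCLM (fun z => α z (spray 0 z)) y := by
  have hsp : HasFDerivAt (spray (0 : Coord n → Rn n)) ((0 : Coord n →L[ℝ] ℝ).prod
      ((ContinuousLinearMap.snd ℝ (Rn n) (Rn n) ∘L ContinuousLinearMap.snd ℝ ℝ _).prod 0)) y :=
    (hasFDerivAt_const _ _).prodMk
      (((ContinuousLinearMap.snd ℝ (Rn n) (Rn n) ∘L
        ContinuousLinearMap.snd ℝ ℝ (Rn n × Rn n)).hasFDerivAt).prodMk (hasFDerivAt_const _ _))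
  have h0 : ∀ a X, fderiv ℝ α y X (du a) = 0 := fun a X => by
    have h1 := hα.hasFDerivAt.clm_apply (hasFDerivAt_const (du a) y)
    have h2 : (fun z => α z (du a)) =ᶠ[𝓝 y] fun _ => (0 : ℝ) := by
      filter_upwards [hv] with z hz using hz a
    have h3 := congrArg (fun T : Coord n →L[ℝ] ℝ => T X)
      (h1.unique ((hasFDerivAt_const (0 : ℝ) y).congr_of_eventuallyEq h2))
    simpa using h3
  have hL : ∀ a, fderiv ℝ (fun z => α z (spray 0 z)) y (du a) = α y (dx a) := fun a => by
    rw [(hα.hasFDerivAt.clm_apply hsp).fderiv]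
    have h1 := hd a
    rw [h0, sub_zero] at h1
    simp only [_root_.add_apply, ContinuousLinearMap.comp_apply, ContinuousLinearMap.flip_apply, h1,
      add_zero]
    rfl
  refine sub_eq_zero.1 (clm_ext_dx (f := 0) (y := y) ?_ (fun a => ?_) (fun a => ?_))
  · rw [_root_.sub_apply, cartanCLM_spray, sub_self]
  · rw [_root_.sub_apply, cartanCLM_dx, hL, sub_self]
  · rw [_root_.sub_apply, cartanCLM_du, hv.self_of_nhds, sub_self]

/-- The projection `(t, x, u) ↦ (t, x, 0)`. -/
noncomputable def projBase (n : ℕ) : Coord n →L[ℝ] Coord n :=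
  (ContinuousLinearMap.fst ℝ ℝ (Rn n × Rn n)).prod
    ((ContinuousLinearMap.fst ℝ (Rn n) (Rn n) ∘L ContinuousLinearMap.snd ℝ ℝ (Rn n × Rn n)).prod 0)

@[simp]
theorem projBase_apply (v : Coord n) : projBase n v = (v.1, (v.2.1, 0)) := rfl

/-- A closed form `g_ab ψ^a ∧ θ^b` on `ℝ × U × ℝⁿ` with `U` star-shaped is `dθ_L`. The primitive is
built in two steps, contracting the fibres first and the base afterwards, so that it vanishes on
the vertical vectors. -/
theorem MultiplierData.exists_lagrangian {U : Set (Rn n)}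
    (D : MultiplierData f g Ω {y | y.2.1 ∈ U}) {c : Rn n} (hc : StarConvex ℝ c U)
    (hclosed : ∀ y : Coord n, y.2.1 ∈ U → extDeriv Ω y = 0) :
    ∃ L : Coord n → ℝ, ContDiffOn ℝ ∞ L {y | y.2.1 ∈ U} ∧
      ∀ y : Coord n, y.2.1 ∈ U → Ω y = extDeriv (cartan L) y := by
  set S : Set (Coord n) := {y | y.2.1 ∈ U} with hSdef
  have hS : IsOpen S := D.isOpen
  have hP : ∀ y ∈ S, projBase n y ∈ S := fun y hy => hy
  -- the restriction of `Ω` to the zero section, pulled back along the projection to it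
  set Ω₂ : Form n 2 := fun y => (Ω (projBase n y)).compContinuousLinearMap (projBase n)
  have hΩ₂ : ContDiffOn ℝ ∞ Ω₂ S := by
    have h : ContDiff ℝ ∞ (ContinuousAlternatingMap.compContinuousLinearMapCLM (ι := Fin 2)
      (F := ℝ) (projBase n)) := ContinuousLinearMap.contDiff _
    exact h.comp_contDiffOn (D.contDiffOn_form.comp (projBase n).contDiff.contDiffOn hP)
  have hΩ₂_apply : ∀ y X Z, Ω₂ y ![X, Z] = Ω (projBase n y) ![projBase n X, projBase n Z] := by
    intro y X Z
    refine congrArg (Ω (projBase n y)) (funext fun i => ?_)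
    fin_cases i <;> rfl
  have hclosed₂ : ∀ y ∈ S, extDeriv Ω₂ y = 0 := fun y hy => by
    have h := extDeriv_pullback (f := projBase n) (x := y) (r := ∞)
      (D.differentiableAt_form (hP y hy)) (projBase n).contDiff.contDiffAt
      minSmoothness_two_le_infty
    simp only [ContinuousLinearMap.fderiv] at h
    rw [show extDeriv Ω₂ y = _ from h, hclosed _ (hP y hy)]
    rfl
  have hdef₁ : ∀ y ∈ S, ∀ s ∈ Set.Icc (0 : ℝ) 1, deform (projBase n) 0 s y ∈ S := by
    intro y hy s _
    have : (deform (projBase n) 0 s y).2.1 = y.2.1 := by simp [deform]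
    simpa only [hSdef, Set.mem_ofPred_eq, this] using hy
  have hdef₂ : ∀ y ∈ S, ∀ s ∈ Set.Icc (0 : ℝ) 1, deform 0 ((0, (c, 0)) : Coord n) s y ∈ S := by
    intro y hy s hs
    have : (deform 0 ((0, (c, 0)) : Coord n) s y).2.1 = c + s • (y.2.1 - c) := by simp [deform]
    simpa only [hSdef, Set.mem_ofPred_eq, this] using hc.add_smul_sub_mem hy hs.1 hs.2
  set α₁ := homotopyForm (projBase n) 0 Ω
  set α₂ := homotopyForm 0 ((0, (c, 0)) : Coord n) Ω₂
  have hα₁ : ContDiffOn ℝ ∞ α₁ S := contDiffOn_homotopyForm hS D.contDiffOn_form hdef₁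
  have hα₂ : ContDiffOn ℝ ∞ α₂ S := contDiffOn_homotopyForm hS hΩ₂ hdef₂
  have hα : ContDiffOn ℝ ∞ (α₁ + α₂) S := hα₁.add hα₂
  have hdiff : ∀ {β : Coord n → Coord n →L[ℝ] ℝ}, ContDiffOn ℝ ∞ β S → ∀ y ∈ S,
      DifferentiableAt ℝ β y := fun h y hy =>
    (h.differentiableOn (by simp)).differentiableAt (hS.mem_nhds hy)
  have hv : ∀ y ∈ S, ∀ a, (α₁ + α₂) y (du a) = 0 := fun y hy a => by
    have h1 : α₁ y (du a) = 0 := by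
      rw [homotopyForm_apply D.contDiffOn_form (hdef₁ y hy)]
      refine (intervalIntegral.integral_congr (g := fun _ => (0 : ℝ)) fun s hs => ?_).trans (by simp)
      rw [Set.uIcc_of_le zero_le_one] at hs
      refine D.form_eq_zero_of_theta (hdef₁ y hy s hs) (fun b => ?_) (fun b => ?_)
      · simp
      · simp [deformLin_apply, du]
    have h2 : α₂ y (du a) = 0 := by
      rw [homotopyForm_apply hΩ₂ (hdef₂ y hy)]
      refine (intervalIntegral.integral_congr (g := fun _ => (0 : ℝ)) fun s hs => ?_).trans (by simp)
      beta_reduce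
      rw [hΩ₂_apply, deformLin_apply, show projBase n (_ + s • (du a - _)) = 0 by
        simp [du], ← toBilin_apply, map_zero]
    rw [Pi.add_apply, _root_.add_apply, h1, h2, add_zero]
  have hdα : ∀ y ∈ S, ∀ X Z, fderiv ℝ (α₁ + α₂) y X Z - fderiv ℝ (α₁ + α₂) y Z X =
      Ω y ![X, Z] := fun y hy X Z => by
    have h1 := fderiv_homotopyForm hS D.contDiffOn_form hclosed (hdef₁ y hy) X Z
    have h2 := fderiv_homotopyForm hS hΩ₂ hclosed₂ (hdef₂ y hy) X Z
    rw [hΩ₂_apply] at h2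
    have h3 : ∀ z, Ω₂ z ![(0 : Coord n →L[ℝ] Coord n) X, (0 : Coord n →L[ℝ] Coord n) Z] = 0 :=
      fun z => by rw [← toBilin_apply]; simp
    rw [h3] at h2
    rw [fderiv_add (hdiff hα₁ y hy) (hdiff hα₂ y hy)]
    simp only [_root_.add_apply]
    simp only [zero_add, sub_zero] at h1 h2
    linarith
  have hcartan : ∀ y ∈ S, (α₁ + α₂) y =
      cartanCLM (fun z => (α₁ + α₂) z (spray 0 z)) y := fun y hy => by
    refine eq_cartanCLM (hdiff hα y hy) ?_ fun a => ?_
    · filter_upwards [hS.mem_nhds hy] with z hz using hv z hz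
    · rw [hdα y hy]
      exact D.form_eq_zero_of_theta hy (fun b => theta_du b a y) (fun b => theta_spray b y)
  refine ⟨fun z => (α₁ + α₂) z (spray 0 z), ?_, fun y hy => ?_⟩
  · refine hα.clm_apply ?_
    exact contDiffOn_const.prodMk ((contDiff_snd.comp contDiff_snd).contDiffOn.prodMk
      contDiffOn_const)
  · have h : cartan (fun z => (α₁ + α₂) z (spray 0 z)) =ᶠ[𝓝 y] fun z =>
        ContinuousAlternatingMap.ofSubsingleton ℝ (Coord n) ℝ (0 : Fin 1) ((α₁ + α₂) z) := by
      filter_upwards [hS.mem_nhds hy] with z hz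
      rw [cartan_eq, hcartan z hz]
    rw [h.extDeriv_eq]
    ext v
    have hv : v = ![v 0, v 1] := by funext i; fin_cases i <;> rfl
    rw [hv, extDeriv_one_apply (hdiff hα y hy), hdα y hy]

end Evolution
end CoordinateTheory

/-! ### Natural coordinates on the evolution space -/

section NaturalCoordinates

namespace Evolution

open Bundle

variable {n : ℕ} {M : Type*} [TopologicalSpace M] [ChartedSpace (Rn n) M] [IsManifold (𝓡 n) ∞ M]
  {e : OpenPartialHomeomorph M (Rn n)}

/-- The natural coordinates `(t, x, u)` on `ℝ × TU` induced by a chart of `M` with domain `U`. -/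
noncomputable def coordMap (e : OpenPartialHomeomorph M (Rn n)) (p : Evo n M) : Coord n :=
  (p.1, (e p.2.proj, mfderiv (𝓡 n) (𝓡 n) e p.2.proj p.2.snd))

omit [ChartedSpace (Rn n) M] [IsManifold (𝓡 n) ∞ M] in
theorem isOpen_coordDom (e : OpenPartialHomeomorph M (Rn n)) : IsOpen (coordDom e) :=
  e.open_target.preimage (continuous_fst.comp continuous_snd)

theorem isOpen_proj_mem_source (e : OpenPartialHomeomorph M (Rn n)) :
    IsOpen {p : Evo n M | p.2.proj ∈ e.source} :=
  e.open_source.preimage ((FiberBundle.continuous_proj (Rn n) (TangentSpace (𝓡 n))).comp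
    continuous_snd)

theorem contMDiffOn_natInv (he : e ∈ Charts n M) :
    ContMDiffOn 𝓘(ℝ, Coord n) (evoModel n) ∞ (natInv e) (coordDom e) := by
  have h1 : ContMDiff 𝓘(ℝ, Coord n) (𝓡 n).tangent ∞
      (fun y : Coord n => (⟨y.2.1, y.2.2⟩ : TangentBundle (𝓡 n) (Rn n))) := by
    intro y
    refine contMDiffAt_totalSpace.2 ⟨?_, ?_⟩
    · exact (contDiff_fst.comp contDiff_snd).contMDiff.contMDiffAt
    · have h : ContMDiff 𝓘(ℝ, Coord n) 𝓘(ℝ, Rn n) ∞ (fun y : Coord n => y.2.2) :=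
        (contDiff_snd.comp contDiff_snd).contMDiff
      refine h.contMDiffAt.congr_of_eventuallyEq (Filter.Eventually.of_forall fun z => ?_)
      simp [trivializationAt_model_space_apply]
  have h2 := (contMDiffOn_symm_of_mem_maximalAtlas he).contMDiffOn_tangentMapWithin
    (m := ∞) (by simp) e.open_target.uniqueMDiffOn
  have h3 := h2.comp h1.contMDiffOn (s := coordDom e) fun y hy => hy
  have h4 : ContMDiffOn 𝓘(ℝ, Coord n) 𝓘(ℝ, ℝ) ∞ (fun y : Coord n => y.1) (coordDom e) :=
    contDiff_fst.contMDiff.contMDiffOn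
  refine (h4.prodMk h3).congr fun y hy => ?_
  simp only [natInv, Function.comp_apply, tangentMapWithin]
  rw [mfderivWithin_of_isOpen e.open_target hy]

theorem contMDiffOn_coordMap (he : e ∈ Charts n M) :
    ContMDiffOn (evoModel n) 𝓘(ℝ, Coord n) ∞ (coordMap e) {p | p.2.proj ∈ e.source} := by
  have h2 := (contMDiffOn_of_mem_maximalAtlas he).contMDiffOn_tangentMapWithin
    (m := ∞) (by simp) e.open_source.uniqueMDiffOn
  have h3 : ContMDiffOn (evoModel n) (𝓡 n).tangent ∞
      (fun p : Evo n M => tangentMapWithin (𝓡 n) (𝓡 n) e e.source p.2)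
      {p | p.2.proj ∈ e.source} :=
    h2.comp contMDiff_snd.contMDiffOn fun y hy => hy
  have h4 : ContMDiffOn (evoModel n) (𝓡 n) ∞
      (fun p : Evo n M => (tangentMapWithin (𝓡 n) (𝓡 n) e e.source p.2).proj)
      {p | p.2.proj ∈ e.source} :=
    (contMDiff_proj (TangentSpace (𝓡 n))).comp_contMDiffOn h3
  have h5 : ContMDiffOn (evoModel n) 𝓘(ℝ, Rn n) ∞
      (fun p : Evo n M => (tangentMapWithin (𝓡 n) (𝓡 n) e e.source p.2).snd)
      {p | p.2.proj ∈ e.source} :=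
    (contMDiff_snd_tangentBundle_modelSpace (Rn n) (𝓡 n)).comp_contMDiffOn h3
  have h6 : ContMDiffOn (evoModel n) 𝓘(ℝ, ℝ) ∞ (fun p : Evo n M => p.1)
      {p | p.2.proj ∈ e.source} := contMDiff_fst.contMDiffOn
  refine (h6.prodMk_space (h4.prodMk_space h5)).congr fun p hp => ?_
  simp only [coordMap, tangentMapWithin]
  rw [mfderivWithin_of_isOpen e.open_source hp]

omit [IsManifold (𝓡 n) ∞ M] in
theorem natInv_proj_mem {y : Coord n} (hy : y ∈ coordDom e) :
    (natInv e y).2.proj ∈ e.source := e.map_target hy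

omit [IsManifold (𝓡 n) ∞ M] in
theorem coordMap_mem {p : Evo n M} (hp : p.2.proj ∈ e.source) : coordMap e p ∈ coordDom e :=
  e.map_source hp

omit [IsManifold (𝓡 n) ∞ M] in
theorem coordMap_natInv (he : e ∈ Charts n M) {y : Coord n} (hy : y ∈ coordDom e) :
    coordMap e (natInv e y) = y := by
  have hy' : y.2.1 ∈ e.target := hy
  have h1 : MDifferentiableAt (𝓡 n) (𝓡 n) e.symm y.2.1 :=
    ((contMDiffOn_symm_of_mem_maximalAtlas he).contMDiffAt
      (e.open_target.mem_nhds hy')).mdifferentiableAt (by simp)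
  have h2 : MDifferentiableAt (𝓡 n) (𝓡 n) e (e.symm y.2.1) :=
    ((contMDiffOn_of_mem_maximalAtlas he).contMDiffAt
      (e.open_source.mem_nhds (e.map_target hy'))).mdifferentiableAt (by simp)
  have h3 : e ∘ e.symm =ᶠ[𝓝 y.2.1] id := by
    filter_upwards [e.open_target.mem_nhds hy'] with z hz using e.right_inv hz
  have h4 := mfderiv_comp y.2.1 h2 h1
  rw [h3.mfderiv_eq, mfderiv_id] at h4
  refine Prod.ext rfl (Prod.ext (e.right_inv hy') ?_)
  exact (congrArg (fun T : Rn n →L[ℝ] Rn n => T y.2.2) h4).symm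

omit [IsManifold (𝓡 n) ∞ M] in
theorem natInv_coordMap (he : e ∈ Charts n M) {p : Evo n M} (hp : p.2.proj ∈ e.source) :
    natInv e (coordMap e p) = p := by
  obtain ⟨t, x, v⟩ := p
  have hx : x ∈ e.source := hp
  have h1 : MDifferentiableAt (𝓡 n) (𝓡 n) e x :=
    ((contMDiffOn_of_mem_maximalAtlas he).contMDiffAt
      (e.open_source.mem_nhds hx)).mdifferentiableAt (by simp)
  have h2 : MDifferentiableAt (𝓡 n) (𝓡 n) e.symm (e x) :=
    ((contMDiffOn_symm_of_mem_maximalAtlas he).contMDiffAt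
      (e.open_target.mem_nhds (e.map_source hx))).mdifferentiableAt (by simp)
  have h3 : e.symm ∘ e =ᶠ[𝓝 x] id := by
    filter_upwards [e.open_source.mem_nhds hx] with z hz using e.left_inv hz
  have h4 := mfderiv_comp x h2 h1
  rw [h3.mfderiv_eq, mfderiv_id] at h4
  have h5 : mfderiv (𝓡 n) (𝓡 n) e.symm (e x) (mfderiv (𝓡 n) (𝓡 n) e x v) = v :=
    (congrArg (fun T : Rn n →L[ℝ] Rn n => T v) h4).symm
  refine Prod.ext rfl ?_
  exact Bundle.TotalSpace.ext (e.left_inv hx) (heq_of_eq h5)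

end Evolution
end NaturalCoordinates

/-! ### Behaviour under changes of charts -/

section ChartChange

set_option maxSynthPendingDepth 3

namespace Evolution

variable {n : ℕ}

/-- The transformation `(t, x, u) ↦ (t, φ(x), Dφ(x) u)` of natural coordinates that is induced by a
transformation `φ` of the coordinates of `M`. -/
noncomputable def prolong (φ : Rn n → Rn n) (y : Coord n) : Coord n :=
  (y.1, (φ y.2.1, fderiv ℝ φ y.2.1 y.2.2))

variable {φ : Rn n → Rn n} {U : Set (Rn n)} {y : Coord n}

theorem contDiffOn_prolong (hU : IsOpen U) (hφ : ContDiffOn ℝ ∞ φ U) :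
    ContDiffOn ℝ ∞ (prolong φ) {y | y.2.1 ∈ U} := by
  have h1 : ContDiff ℝ ∞ (fun y : Coord n => y.2.1) := contDiff_fst.comp contDiff_snd
  have h2 : ContDiff ℝ ∞ (fun y : Coord n => y.2.2) := contDiff_snd.comp contDiff_snd
  exact contDiff_fst.contDiffOn.prodMk ((hφ.comp h1.contDiffOn fun y hy => hy).prodMk
    ((((contDiffOn_infty_iff_fderiv_of_isOpen hU).1 hφ).2.comp h1.contDiffOn
      fun y hy => hy).clm_apply h2.contDiffOn))

theorem fderiv_prolong (hU : IsOpen U) (hφ : ContDiffOn ℝ ∞ φ U) (hy : y.2.1 ∈ U) (v : Coord n) :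
    fderiv ℝ (prolong φ) y v = (v.1, (fderiv ℝ φ y.2.1 v.2.1,
      fderiv ℝ (fderiv ℝ φ) y.2.1 v.2.1 y.2.2 + fderiv ℝ φ y.2.1 v.2.2)) := by
  have h1 : HasFDerivAt (fun y : Coord n => y.2.1) (ContinuousLinearMap.fst ℝ (Rn n) (Rn n) ∘L
      ContinuousLinearMap.snd ℝ ℝ (Rn n × Rn n)) y :=
    (ContinuousLinearMap.fst ℝ (Rn n) (Rn n) ∘L
      ContinuousLinearMap.snd ℝ ℝ (Rn n × Rn n)).hasFDerivAt
  have h2 : HasFDerivAt (fun y : Coord n => y.2.2) (ContinuousLinearMap.snd ℝ (Rn n) (Rn n) ∘L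
      ContinuousLinearMap.snd ℝ ℝ (Rn n × Rn n)) y :=
    (ContinuousLinearMap.snd ℝ (Rn n) (Rn n) ∘L
      ContinuousLinearMap.snd ℝ ℝ (Rn n × Rn n)).hasFDerivAt
  have h3 : HasFDerivAt φ (fderiv ℝ φ y.2.1) y.2.1 :=
    ((hφ.differentiableOn (by simp)).differentiableAt (hU.mem_nhds hy)).hasFDerivAt
  have h4 : HasFDerivAt (fderiv ℝ φ) (fderiv ℝ (fderiv ℝ φ) y.2.1) y.2.1 :=
    ((((contDiffOn_infty_iff_fderiv_of_isOpen hU).1 hφ).2.differentiableOn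
      (by simp)).differentiableAt (hU.mem_nhds hy)).hasFDerivAt
  have h5 : HasFDerivAt (fun z : Coord n => φ z.2.1) _ y := HasFDerivAt.comp (g := φ) y h3 h1
  have h6 : HasFDerivAt (fun z : Coord n => fderiv ℝ φ z.2.1) _ y :=
    HasFDerivAt.comp (g := fderiv ℝ φ) y h4 h1
  have h7 : HasFDerivAt (prolong φ) _ y := hasFDerivAt_fst.prodMk (h5.prodMk (h6.clm_apply h2))
  rw [h7.fderiv]
  simp [add_comm]

theorem cartanCLM_vert (L : Coord n → ℝ) (y : Coord n) (w : Rn n) :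
    cartanCLM L y (0, (0, w)) = 0 := clm_vert_eq_zero (cartanCLM_du L y) w

theorem cartanCLM_hor (L : Coord n → ℝ) (y : Coord n) (w : Rn n) :
    cartanCLM L y (0, (w, 0)) = fderiv ℝ L y (0, (0, w)) := by
  rw [hor_eq_sum, vert_eq_sum, map_sum, map_sum]
  simp only [map_smul, cartanCLM_dx]

/-- The Cartan form does not depend on the choice of natural coordinates. -/
theorem cartanCLM_comp_prolong (hU : IsOpen U) (hφ : ContDiffOn ℝ ∞ φ U) (hy : y.2.1 ∈ U)
    {L : Coord n → ℝ} (hL : DifferentiableAt ℝ L (prolong φ y)) :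
    cartanCLM (L ∘ prolong φ) y = (cartanCLM L (prolong φ y)).comp (fderiv ℝ (prolong φ) y) := by
  have hd : DifferentiableAt ℝ (prolong φ) y :=
    ((contDiffOn_prolong hU hφ).differentiableOn (by simp)).differentiableAt
      ((hU.preimage (continuous_fst.comp continuous_snd)).mem_nhds hy)
  have hsplit : ∀ (t : ℝ) (x u : Rn n), ((t, (x, u)) : Coord n) = (t, (x, 0)) + (0, (0, u)) := by
    intro t x u; simp
  refine sub_eq_zero.1 (clm_ext_dx (f := 0) (y := y) ?_ (fun a => ?_) (fun a => ?_))
  · rw [_root_.sub_apply, cartanCLM_spray, ContinuousLinearMap.comp_apply,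
      fderiv_prolong hU hφ hy]
    refine sub_eq_zero.2 ?_
    exact (cartanCLM_spray (f := fun _ => fderiv ℝ (fderiv ℝ φ) y.2.1 (spray 0 y).2.1 y.2.2
      + fderiv ℝ φ y.2.1 (spray 0 y).2.2) L (prolong φ y)).symm
  · rw [_root_.sub_apply, cartanCLM_dx, ContinuousLinearMap.comp_apply, fderiv_comp y hL hd,
      ContinuousLinearMap.comp_apply, fderiv_prolong hU hφ hy, fderiv_prolong hU hφ hy, hsplit,
      hsplit (dx a).1, map_add (cartanCLM L _), cartanCLM_vert]
    simp only [dx, du, cartanCLM_hor]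
    simp
  · rw [_root_.sub_apply, cartanCLM_du, ContinuousLinearMap.comp_apply, fderiv_prolong hU hφ hy]
    simp only [du, map_zero]
    rw [cartanCLM_vert, sub_zero]

end Evolution
end ChartChange

section Manifold

set_option maxSynthPendingDepth 3

namespace Evolution

variable {n : ℕ} {M : Type*} [TopologicalSpace M] [ChartedSpace (Rn n) M]
  {e e' : OpenPartialHomeomorph M (Rn n)}

/-- The set of coordinates of the points of the domain of `e'` that lie in the domain of `e`. -/
def overlap (e e' : OpenPartialHomeomorph M (Rn n)) : Set (Rn n) :=
  e'.target ∩ e'.symm ⁻¹' e.source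

omit [ChartedSpace (Rn n) M] in
theorem isOpen_overlap : IsOpen (overlap e e') :=
  e'.continuousOn_symm.isOpen_inter_preimage e'.open_target e.open_source

variable [IsManifold (𝓡 n) ∞ M]

omit [IsManifold (𝓡 n) ∞ M] in
theorem contDiffOn_transition (he : e ∈ Charts n M) (he' : e' ∈ Charts n M) :
    ContDiffOn ℝ ∞ (e ∘ e'.symm) (overlap e e') :=
  contMDiffOn_iff_contDiffOn.1 ((contMDiffOn_of_mem_maximalAtlas he).comp
    ((contMDiffOn_symm_of_mem_maximalAtlas he').mono Set.inter_subset_left) fun _ hy => hy.2)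

omit [IsManifold (𝓡 n) ∞ M] in
theorem coordMap_natInv_eq_prolong (he : e ∈ Charts n M) (he' : e' ∈ Charts n M) {y : Coord n}
    (hy : y.2.1 ∈ overlap e e') : coordMap e (natInv e' y) = prolong (e ∘ e'.symm) y := by
  have h1 : MDifferentiableAt (𝓡 n) (𝓡 n) e'.symm y.2.1 :=
    ((contMDiffOn_symm_of_mem_maximalAtlas he').contMDiffAt
      (e'.open_target.mem_nhds hy.1)).mdifferentiableAt (by simp)
  have h2 : MDifferentiableAt (𝓡 n) (𝓡 n) e (e'.symm y.2.1) :=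
    ((contMDiffOn_of_mem_maximalAtlas he).contMDiffAt
      (e.open_source.mem_nhds hy.2)).mdifferentiableAt (by simp)
  have h4 := mfderiv_comp y.2.1 h2 h1
  rw [mfderiv_eq_fderiv] at h4
  refine Prod.ext rfl (Prod.ext rfl ?_)
  exact (congrArg (fun T : Rn n →L[ℝ] Rn n => T y.2.2) h4).symm

omit [IsManifold (𝓡 n) ∞ M] in
theorem natInv_eq_natInv_prolong (he : e ∈ Charts n M) (he' : e' ∈ Charts n M) {y : Coord n}
    (hy : y.2.1 ∈ overlap e e') : natInv e' y = natInv e (prolong (e ∘ e'.symm) y) := by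
  rw [← coordMap_natInv_eq_prolong he he' hy, natInv_coordMap (p := natInv e' y) he hy.2]

theorem mdifferentiableAt_natInv (he : e ∈ Charts n M) {y : Coord n} (hy : y ∈ coordDom e) :
    MDifferentiableAt 𝓘(ℝ, Coord n) (evoModel n) (natInv e) y :=
  ((contMDiffOn_natInv he).contMDiffAt ((isOpen_coordDom e).mem_nhds hy)).mdifferentiableAt
    (by simp)

theorem mdifferentiableAt_coordMap (he : e ∈ Charts n M) {p : Evo n M} (hp : p.2.proj ∈ e.source) :
    MDifferentiableAt (evoModel n) 𝓘(ℝ, Coord n) (coordMap e) p :=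
  ((contMDiffOn_coordMap he).contMDiffAt
    ((isOpen_proj_mem_source e).mem_nhds hp)).mdifferentiableAt (by simp)

/-- The natural coordinates identify the tangent spaces of the evolution space with the
coordinate space. -/
theorem exists_equiv_mfderiv_natInv (he : e ∈ Charts n M) {y : Coord n} (hy : y ∈ coordDom e) :
    ∃ A : Coord n ≃L[ℝ] Coord n, ∀ v : Coord n,
      mfderiv 𝓘(ℝ, Coord n) (evoModel n) (natInv e) y v = A v := by
  have hp := natInv_proj_mem (M := M) hy
  have h1 := mfderiv_comp y (mdifferentiableAt_coordMap he hp) (mdifferentiableAt_natInv he hy)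
  have h2 : coordMap e ∘ natInv e =ᶠ[𝓝 y] id := by
    filter_upwards [(isOpen_coordDom e).mem_nhds hy] with z hz using coordMap_natInv he hz
  rw [h2.mfderiv_eq, mfderiv_id] at h1
  have h3 : MDifferentiableAt 𝓘(ℝ, Coord n) (evoModel n) (natInv e) (coordMap e (natInv e y)) := by
    rw [coordMap_natInv he hy]; exact mdifferentiableAt_natInv he hy
  have h4 := mfderiv_comp (natInv e y) h3 (mdifferentiableAt_coordMap he hp)
  have h5 : natInv e ∘ coordMap e =ᶠ[𝓝 (natInv e y)] id := by
    filter_upwards [(isOpen_proj_mem_source e).mem_nhds hp] with z hz using natInv_coordMap he hz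
  rw [h5.mfderiv_eq, mfderiv_id, coordMap_natInv he hy] at h4
  refine ⟨ContinuousLinearEquiv.equivOfInverse
    (mfderiv 𝓘(ℝ, Coord n) (evoModel n) (natInv e) y : Coord n →L[ℝ] Coord n)
    (mfderiv (evoModel n) 𝓘(ℝ, Coord n) (coordMap e) (natInv e y) : Coord n →L[ℝ] Coord n)
    (fun v => ?_) (fun v => ?_), fun v => rfl⟩
  · exact (congrArg (fun T : Coord n →L[ℝ] Coord n => T v) h1).symm
  · exact (congrArg (fun T : Coord n →L[ℝ] Coord n => T v) h4).symm

theorem formIn_eq_pullback (Ω : EvoForm n M) (he : e ∈ Charts n M) (he' : e' ∈ Charts n M)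
    {y : Coord n} (hy : y.2.1 ∈ overlap e e') :
    formIn e' Ω y = (formIn e Ω (prolong (e ∘ e'.symm) y)).compContinuousLinearMap
      (fderiv ℝ (prolong (e ∘ e'.symm)) y) := by
  have hO : IsOpen {y : Coord n | y.2.1 ∈ overlap e e'} :=
    isOpen_overlap.preimage (continuous_fst.comp continuous_snd)
  have h1 : natInv (M := M) e' =ᶠ[𝓝 y] natInv e ∘ prolong (e ∘ e'.symm) := by
    filter_upwards [hO.mem_nhds hy] with z hz using natInv_eq_natInv_prolong he he' hz
  have hd : DifferentiableAt ℝ (prolong (e ∘ e'.symm)) y :=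
    ((contDiffOn_prolong isOpen_overlap (contDiffOn_transition he he')).differentiableOn
      (by simp)).differentiableAt (hO.mem_nhds hy)
  have hm : prolong (e ∘ e'.symm) y ∈ coordDom e := by
    rw [← coordMap_natInv_eq_prolong he he' hy]
    exact coordMap_mem hy.2
  have h2 := mfderiv_comp y (mdifferentiableAt_natInv he hm) hd.mdifferentiableAt
  rw [mfderiv_eq_fderiv] at h2
  have h3 : ∀ v : Coord n, (mfderiv 𝓘(ℝ, Coord n) (evoModel n) (natInv (M := M) e') y v : Coord n) =
      mfderiv 𝓘(ℝ, Coord n) (evoModel n) (natInv (M := M) e) (prolong (e ∘ e'.symm) y)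
        (fderiv ℝ (prolong (e ∘ e'.symm)) y v) := fun v => by
    rw [h1.mfderiv_eq]
    exact congrArg (fun T : Coord n →L[ℝ] Coord n => T v) h2
  ext v
  have hp : natInv (M := M) e' y = natInv e (prolong (e ∘ e'.symm) y) :=
    natInv_eq_natInv_prolong he he' hy
  have key : ∀ (p q : Evo n M) (hpq : p = q) (w w' : Fin 2 → Coord n), w = w' →
      (Ω p : Coord n [⋀^Fin 2]→L[ℝ] ℝ) w = (Ω q : Coord n [⋀^Fin 2]→L[ℝ] ℝ) w' := by
    rintro p _ rfl w _ rfl; rfl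
  exact key _ _ hp _ _ (funext fun i => h3 (v i))

end Evolution
end Manifold

/-! ### The equivalence -/

section Equivalence

namespace Evolution

variable {n : ℕ} {M : Type*} [TopologicalSpace M] [ChartedSpace (Rn n) M] [IsManifold (𝓡 n) ∞ M]
  {e e' : OpenPartialHomeomorph M (Rn n)} {G : EvoField n M} {Ω : EvoForm n M}

theorem exists_multiplierData (hG : IsSemispray G) (hΩ : IsMultiplierForm G Ω)
    (he : e ∈ Charts n M) :
    ∃ g, MultiplierData (forceIn e G) g (formIn e Ω) (coordDom e) := by
  obtain ⟨g, hg, hform⟩ := hΩ e he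
  exact ⟨g, isOpen_coordDom e,
    (contDiff_snd.comp contDiff_snd).comp_contDiffOn (hG e he).1, hg, hform⟩

theorem finrank_range_iff_det_ne_zero (he : e ∈ Charts n M) {f : Coord n → Rn n}
    {g : Fin n → Fin n → Coord n → ℝ} (D : MultiplierData f g (formIn e Ω) (coordDom e))
    {y : Coord n} (hy : y ∈ coordDom e) :
    Module.finrank ℝ (LinearMap.range (Ω (natInv e y)).toAlternatingMap.curryLeft) = 2 * n ↔
      (Matrix.of fun a b => g a b y).det ≠ 0 := by
  obtain ⟨A, hA⟩ := exists_equiv_mfderiv_natInv (M := M) he hy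
  have hform : ∀ X Y : Coord n, formIn e Ω y ![X, Y] =
      (Ω (natInv e y) : Coord n [⋀^Fin 2]→L[ℝ] ℝ) ![A X, A Y] := fun X Y => by
    refine congrArg (Ω (natInv e y) : Coord n [⋀^Fin 2]→L[ℝ] ℝ) (funext fun i => ?_)
    fin_cases i
    · exact hA X
    · exact hA Y
  have hne : A (spray f y) ≠ 0 := fun h => by
    have h1 := (map_eq_zero_iff A A.injective).1 h
    exact one_ne_zero (congrArg Prod.fst h1)
  have hdim : Module.finrank ℝ (Coord n) = 2 * n + 1 := by
    simp; ring
  refine (finrank_range_curryLeft_iff hdim (Ω (natInv e y) : Coord n [⋀^Fin 2]→L[ℝ] ℝ) hne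
    fun Y => ?_).trans (Iff.trans ?_ (D.ker_iff_det_ne_zero hy))
  · obtain ⟨Y, rfl⟩ := A.surjective Y
    exact (hform _ _).symm.trans (D.form_spray_left hy _)
  · refine A.surjective.forall.trans (forall_congr' fun X => imp_congr ?_ ?_)
    · exact A.surjective.forall.trans (forall_congr' fun Y =>
        iff_of_eq (congrArg (· = (0 : ℝ)) (hform X Y).symm))
    · exact exists_congr fun c => by rw [← map_smul, A.injective.eq_iff]

theorem hasMaximalRank_iff (hD : ∀ e ∈ Charts n M, ∃ g,
    MultiplierData (forceIn e G) g (formIn e Ω) (coordDom e)) :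
    HasMaximalRank Ω ↔ ∀ e ∈ Charts n M, ∀ g,
      MultiplierData (forceIn e G) g (formIn e Ω) (coordDom e) →
        ∀ y ∈ coordDom e, (Matrix.of fun a b => g a b y).det ≠ 0 := by
  constructor
  · intro h e he g D y hy
    exact (finrank_range_iff_det_ne_zero he D hy).1 (h _)
  · intro h p
    have he : chartAt (Rn n) p.2.proj ∈ Charts n M := IsManifold.chart_mem_maximalAtlas _
    have hp : p.2.proj ∈ (chartAt (Rn n) p.2.proj).source := mem_chart_source _ _
    obtain ⟨g, D⟩ := hD _ he
    have h1 := (finrank_range_iff_det_ne_zero he D (coordMap_mem hp)).2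
      (h _ he g D _ (coordMap_mem hp))
    rwa [natInv_coordMap he hp] at h1

/-- If `Ω = g_ab ψ^a ∧ θ^b` is the exterior derivative of the Cartan form of `L`, then the Hessian
of `L` along the fibres is `(g_ab)`: both are the component of `Ω` on `(∂/∂u^a, ∂/∂x^b)`. -/
theorem hessian_eq {f : Coord n → Rn n} {g : Fin n → Fin n → Coord n → ℝ} {Ω : Form n 2}
    {S N : Set (Coord n)} (D : MultiplierData f g Ω S) (hN : IsOpen N) (hNS : N ⊆ S)
    {L : Coord n → ℝ} (hL : ContDiffOn ℝ ∞ L N) {y : Coord n} (hy : y ∈ N)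
    (h : Ω y = extDeriv (cartan L) y) : hessian L y = Matrix.of fun a b => g a b y := by
  ext a b
  rw [← extDeriv_cartan_du_dx (((contDiffOn_cartanCLM hN hL).differentiableOn
    (by simp)).differentiableAt (hN.mem_nhds hy)), ← h, D.form_du_dx (hNS hy)]
  rfl

theorem conditions_of_extDeriv_eq_zero {f : Coord n → Rn n} {g : Fin n → Fin n → Coord n → ℝ}
    {Ω : Form n 2} {S : Set (Coord n)} (D : MultiplierData f g Ω S) {y : Coord n} (hy : y ∈ S)
    (h : extDeriv Ω y = 0) :
    (∀ a b, TForm f Ω (spray f) (V a) (V b) y = 0) ∧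
    (∀ a b, TForm f Ω (spray f) (H f a) (H f b) y = 0) ∧
    (∀ a b, Xi f Ω (spray f) (V a) (H f b) y = 0) ∧
    (∀ a b c, Xi f Ω (V a) (V b) (H f c) y = 0) := by
  refine ⟨fun a b => ?_, fun a b => ?_, fun a b => ?_, fun a b c => ?_⟩
  · rw [D.TForm_spray_V_V hy, h]; rfl
  · rw [D.TForm_spray_H_H hy, h]; rfl
  · rw [D.Xi_spray_V_H hy, h]; exact neg_zero
  · rw [D.Xi_V_V_H hy, h]; exact neg_zero

theorem maximalRank_and_conditions_of_isLocallyDCartan (hG : IsSemispray G)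
    (hΩ : IsMultiplierForm G Ω) (h : IsLocallyDCartan Ω) :
    HasMaximalRank Ω ∧ ComponentConditions G Ω := by
  have key : ∀ e ∈ Charts n M, ∀ y ∈ coordDom e, ∃ N : Set (Coord n), IsOpen N ∧ y ∈ N ∧
      N ⊆ coordDom e ∧ ∃ L : Coord n → ℝ, ContDiffOn ℝ ∞ L N ∧ (hessian L y).det ≠ 0 ∧
        ∀ z ∈ N, formIn e Ω z = extDeriv (cartan L) z := by
    intro e he y hy
    obtain ⟨W, hW, hpW, L, ⟨hL, hreg⟩, hd⟩ := h (natInv e y)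
    refine ⟨coordDom e ∩ natInv e ⁻¹' W,
      (contMDiffOn_natInv he).continuousOn.isOpen_inter_preimage (isOpen_coordDom e) hW,
      ⟨hy, hpW⟩, Set.inter_subset_left, L ∘ natInv e, ?_, hreg e he y hy hpW,
      fun z hz => hd e he z hz.1 hz.2⟩
    exact contMDiffOn_iff_contDiffOn.1
      (hL.comp ((contMDiffOn_natInv he).mono Set.inter_subset_left) fun z hz => hz.2)
  constructor
  · refine (hasMaximalRank_iff fun e he => exists_multiplierData hG hΩ he).2
      fun e he g D y hy => ?_
    obtain ⟨N, hN, hyN, hNS, L, hL, hdet, hd⟩ := key e he y hy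
    rwa [← hessian_eq D hN hNS hL hyN (hd y hyN)]
  · intro e he y hy
    obtain ⟨g, D⟩ := exists_multiplierData hG hΩ he
    obtain ⟨N, hN, hyN, hNS, L, hL, hdet, hd⟩ := key e he y hy
    refine conditions_of_extDeriv_eq_zero D hy ?_
    have h1 : formIn e Ω =ᶠ[𝓝 y] extDeriv (cartan L) := by
      filter_upwards [hN.mem_nhds hyN] with z hz using hd z hz
    rw [h1.extDeriv_eq]
    exact extDeriv_extDeriv_apply ((contDiffOn_cartan hN hL).contDiffAt (hN.mem_nhds hyN))
      minSmoothness_two_le_infty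

theorem extDeriv_formIn_eq_zero (hG : IsSemispray G) (hΩ : IsMultiplierForm G Ω)
    (hc : ComponentConditions G Ω) (he : e ∈ Charts n M) {y : Coord n} (hy : y ∈ coordDom e) :
    extDeriv (formIn e Ω) y = 0 := by
  obtain ⟨g, D⟩ := exists_multiplierData hG hΩ he
  refine D.extDeriv_eq_zero (fun z hz a b => ?_) (fun z hz a b => ?_) (fun z hz a b => ?_)
    (fun z hz a b c => ?_) hy
  · rw [← D.TForm_spray_V_V hz, (hc e he z hz).1]
  · rw [← D.TForm_spray_H_H hz, (hc e he z hz).2.1]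
  · rw [← neg_eq_zero, ← D.Xi_spray_V_H hz, (hc e he z hz).2.2.1]
  · rw [← neg_eq_zero, ← D.Xi_V_V_H hz, (hc e he z hz).2.2.2]

/-- The Lagrangian found in the natural coordinates of a chart is transported to the evolution
space; it serves in all other charts as the Cartan form is natural. Its regularity is a consequence
of the maximal rank of `Ω`. -/
theorem exists_lagrangian_of_starConvex (hG : IsSemispray G) (hΩ : IsMultiplierForm G Ω)
    (hrank : HasMaximalRank Ω) (hc : ComponentConditions G Ω) (he : e ∈ Charts n M) {c : Rn n}
    (hstar : StarConvex ℝ c e.target) :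
    ∃ L : Evo n M → ℝ, IsRegularLagrangianOn L {p | p.2.proj ∈ e.source} ∧
      EqDCartanOn Ω L {p | p.2.proj ∈ e.source} := by
  obtain ⟨g, D⟩ := exists_multiplierData hG hΩ he
  obtain ⟨L, hL, hdL⟩ := MultiplierData.exists_lagrangian (U := e.target) D hstar
    fun y hy => extDeriv_formIn_eq_zero hG hΩ hc he hy
  have hsmooth : ContMDiffOn (evoModel n) 𝓘(ℝ, ℝ) ∞ (L ∘ coordMap e) {p | p.2.proj ∈ e.source} :=
    hL.contMDiffOn.comp (contMDiffOn_coordMap he) fun p hp => coordMap_mem hp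
  have hOpen : ∀ e' : OpenPartialHomeomorph M (Rn n),
      IsOpen {y : Coord n | y.2.1 ∈ overlap e e'} := fun e' =>
    isOpen_overlap.preimage (continuous_fst.comp continuous_snd)
  have hloc : ∀ e' ∈ Charts n M, ∀ y : Coord n, y.2.1 ∈ overlap e e' →
      ((L ∘ coordMap e) ∘ natInv e') y = (L ∘ prolong (e ∘ e'.symm)) y := fun e' he' y hy =>
    congrArg L (coordMap_natInv_eq_prolong he he' hy)
  have hmem : ∀ e' ∈ Charts n M, ∀ y : Coord n, y.2.1 ∈ overlap e e' →
      prolong (e ∘ e'.symm) y ∈ coordDom e := fun e' he' y hy => e.map_source hy.2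
  have heq : EqDCartanOn Ω (L ∘ coordMap e) {p | p.2.proj ∈ e.source} := by
    intro e' he' y hy hyW
    have hyO : y.2.1 ∈ overlap e e' := ⟨hy, hyW⟩
    have hφ := contDiffOn_transition he he'
    have hLd : ∀ z ∈ coordDom e, DifferentiableAt ℝ L z := fun z hz =>
      (hL.differentiableOn (by simp)).differentiableAt ((isOpen_coordDom e).mem_nhds hz)
    have h1 : cartan ((L ∘ coordMap e) ∘ natInv e') =ᶠ[𝓝 y] fun z =>
        (cartan L (prolong (e ∘ e'.symm) z)).compContinuousLinearMap
          (fderiv ℝ (prolong (e ∘ e'.symm)) z) := by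
      filter_upwards [(hOpen e').mem_nhds hyO] with z hz
      have h2 : ((L ∘ coordMap e) ∘ natInv e') =ᶠ[𝓝 z] L ∘ prolong (e ∘ e'.symm) := by
        filter_upwards [(hOpen e').mem_nhds hz] with w hw using hloc e' he' w hw
      have h3 : cartanCLM ((L ∘ coordMap e) ∘ natInv e') z =
          cartanCLM (L ∘ prolong (e ∘ e'.symm)) z := by
        rw [cartanCLM, cartanCLM, h2.fderiv_eq, h2.eq_of_nhds]
      rw [cartan_eq, cartan_eq]
      beta_reduce
      rw [h3, cartanCLM_comp_prolong isOpen_overlap hφ hz (hLd _ (hmem e' he' z hz))]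
      rfl
    rw [h1.extDeriv_eq, extDeriv_pullback (r := ∞)
      (((contDiffOn_cartan (isOpen_coordDom e) hL).differentiableOn (by simp)).differentiableAt
        ((isOpen_coordDom e).mem_nhds (hmem e' he' y hyO)))
      ((contDiffOn_prolong isOpen_overlap hφ).contDiffAt ((hOpen e').mem_nhds hyO))
      minSmoothness_two_le_infty, formIn_eq_pullback Ω he he' hyO, hdL _ (hmem e' he' y hyO)]
  refine ⟨L ∘ coordMap e, ⟨hsmooth, fun e' he' y hy hyW => ?_⟩, heq⟩
  obtain ⟨g', D'⟩ := exists_multiplierData hG hΩ he'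
  have hyO : y.2.1 ∈ overlap e e' := ⟨hy, hyW⟩
  have hL' : ContDiffOn ℝ ∞ ((L ∘ coordMap e) ∘ natInv e') {y : Coord n | y.2.1 ∈ overlap e e'} :=
    contMDiffOn_iff_contDiffOn.1 (hsmooth.comp
      ((contMDiffOn_natInv he').mono fun z hz => hz.1) fun z hz => hz.2)
  rw [hessian_eq D' (hOpen e') (fun z hz => hz.1) hL' hyO (heq e' he' y hy hyW)]
  exact (hasMaximalRank_iff fun e he => exists_multiplierData hG hΩ he).1 hrank e' he' g' D' y hy

/-- Every point lies in the domain of a chart whose image is a ball. -/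
theorem exists_chart_starConvex (x : M) :
    ∃ e ∈ Charts n M, x ∈ e.source ∧ ∃ c, StarConvex ℝ c e.target := by
  set e₀ := chartAt (Rn n) x
  have hx : x ∈ e₀.source := mem_chart_source _ _
  obtain ⟨r, hr, hball⟩ := Metric.isOpen_iff.1 e₀.open_target (e₀ x) (e₀.map_source hx)
  have hs : IsOpen (e₀.source ∩ e₀ ⁻¹' Metric.ball (e₀ x) r) :=
    e₀.continuousOn.isOpen_inter_preimage e₀.open_source Metric.isOpen_ball
  refine ⟨e₀.restr (e₀.source ∩ e₀ ⁻¹' Metric.ball (e₀ x) r),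
    restr_mem_maximalAtlas _ (IsManifold.chart_mem_maximalAtlas _) hs, ?_, e₀ x, ?_⟩
  · rw [e₀.restr_source' _ hs]
    exact ⟨hx, hx, Metric.mem_ball_self hr⟩
  · have : (e₀.restr (e₀.source ∩ e₀ ⁻¹' Metric.ball (e₀ x) r)).target =
        Metric.ball (e₀ x) r := by
      change e₀.target ∩ e₀.symm ⁻¹' interior _ = _
      rw [hs.interior_eq]
      ext z
      constructor
      · rintro ⟨hz, -, hz'⟩
        rwa [Set.mem_preimage, e₀.right_inv hz] at hz'
      · intro hz
        refine ⟨hball hz, e₀.map_target (hball hz), ?_⟩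
        rwa [Set.mem_preimage, e₀.right_inv (hball hz)]
    rw [this]
    exact (convex_ball _ _).starConvex (Metric.mem_ball_self hr)

end Evolution
end Equivalence

theorem mainTheorem10 (n : ℕ) (M : Type*) [TopologicalSpace M]
    [ChartedSpace (EuclideanSpace ℝ (Fin n)) M] [IsManifold (𝓡 n) ∞ M]
    (G : Evolution.EvoField n M) (hG : Evolution.IsSemispray G)
    (Ω : Evolution.EvoForm n M) (hΩ : Evolution.IsMultiplierForm G Ω) :
    (Evolution.IsLocallyDCartan Ω ↔
      Evolution.HasMaximalRank Ω ∧ Evolution.ComponentConditions G Ω) ∧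
    (Evolution.HasMaximalRank Ω ∧ Evolution.ComponentConditions G Ω →
      ∀ e ∈ Evolution.Charts n M, (∃ c, StarConvex ℝ c e.target) →
        ∃ L : Evolution.Evo n M → ℝ,
          Evolution.IsRegularLagrangianOn L {p | p.2.proj ∈ e.source} ∧
          Evolution.EqDCartanOn Ω L {p | p.2.proj ∈ e.source}) := by
  refine ⟨⟨Evolution.maximalRank_and_conditions_of_isLocallyDCartan hG hΩ, ?_⟩, ?_⟩
  · rintro ⟨hrank, hc⟩ p
    obtain ⟨e, he, hp, c, hstar⟩ := Evolution.exists_chart_starConvex (n := n) p.2.proj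
    exact ⟨{p | p.2.proj ∈ e.source}, Evolution.isOpen_proj_mem_source e, hp,
      Evolution.exists_lagrangian_of_starConvex hG hΩ hrank hc he hstar⟩
  · rintro ⟨hrank, hc⟩ e he ⟨c, hstar⟩
    exact Evolution.exists_lagrangian_of_starConvex hG hΩ hrank hc he hstar
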